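/- All rings are commutative. Let $(R,\mathfrak m)$ be a Noetherian local ring of dimension $d$ and let $B$ be an $R$-algebra which is strict, i.e. $B\ne\mathfrak m B$. Let $v:B\to\mathbb R\cup\{\infty\}$ be a value map, i.e. $v(ab)=v(a)+v(b)$ and $v(a+b)\ge\min\{v(a),v(b)\}$ for all $a,b\in B$, and $v(0)=\infty$; assume that $v$ is not identically $\infty$. A $B$-module $M$ is called almost zero, written $M\approx 0$, if for every $m\in M$ and every $\varepsilon>0$ there is $b\in B$ with $bm=0$ and $v(b)<\varepsilon$. For a sequence $\underline x=x_1,\ldots,x_d$ in $R$ and $1\le i\le d$ write $\underline x_{i-1}=x_1,\ldots,x_{i-1}$; let $H_i(\underline x;B)$ denote Koszul homology, and let $H^i_{\mathfrak m}(B)$ denote local cohomology, i.e. the $i$-th cohomology of the Čech complex of $B$ with respect to a finite sequence of generators of $\mathfrak m$. Consider the following statements. (a) $\dfrac{\big((\underline x_{i-1})B:_B x_i\big)}{(\underline x_{i-1})B}\approx 0$ for $1\le i\le d$ and every system of parameters $\underline x=x_1,\ldots,x_d$ of $R$. (b) $H_i(\underline x;B)\approx 0$ for all $i>0$ and every system of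 parameters $\underline x=x_1,\ldots,x_d$ of $R$. (c) $H^i_{\mathfrak m}(B)\approx 0$ for all $i<d$. Then: (i) (a) $\Rightarrow$ (b) $\Rightarrow$ (c). (ii) Suppose that $v$ is normalized, i.e. $v(c)\ge 0$ for all $c\in B$ and $v(c)>0$ for every non-unit $c\in B$, that $B$ is quasilocal (it has exactly one maximal ideal), and that $B$ is coherent (every finitely generated ideal of $B$ is finitely presented). Then (c) implies that $B$ is a balanced big Cohen-Macaulay $R$-algebra, i.e. every system of parameters $x_1,\ldots,x_d$ of $R$ is a regular sequence on $B$: for each $1\le i\le d$, $x_i$ is a non-zero-divisor on $B/(\underline x_{i-1})B$, and $B/(\underline x)B\neq 0$. -/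

import Mathlib

universe u w

/-! ## Value maps and almost zero modules -/

/-- A value map on a ring `T`: a map `v : T → ℝ ∪ {∞}` with `v (a b) = v a + v b`,
`v (a + b) ≥ min (v a) (v b)` and `v 0 = ∞`.  Neither `T` is a domain nor is `v⁻¹ {∞} = 0`. -/
structure ValueMap (T : Type*) [CommRing T] where
  toFun : T → WithTop ℝ
  map_mul' : ∀ a b, toFun (a * b) = toFun a + toFun b
  min_le_map_add' : ∀ a b, min (toFun a) (toFun b) ≤ toFun (a + b)
  map_zero' : toFun 0 = ⊤

instance {T : Type*} [CommRing T] : CoeFun (ValueMap T) (fun _ => T → WithTop ℝ) :=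
  ⟨ValueMap.toFun⟩

/-- A value map is normalized if it is nonnegative, and positive on non-units. -/
def ValueMap.IsNormalized {T : Type*} [CommRing T] (v : ValueMap T) : Prop :=
  (∀ c, 0 ≤ v c) ∧ ∀ c, ¬ IsUnit c → 0 < v c

/-- `M` is almost zero with respect to `v`: every element of `M` is annihilated by elements of
arbitrarily small value. -/
def IsAlmostZero {T : Type*} [CommRing T] (v : ValueMap T)
    (M : Type*) [AddCommGroup M] [Module T M] : Prop :=
  ∀ m : M, ∀ ε : ℝ, 0 < ε → ∃ b : T, b • m = 0 ∧ v b < (ε : WithTop ℝ)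

/-! ## Coherent modules and rings -/

/-- A module is coherent if it is finitely generated and every finitely generated submodule is
finitely presented. -/
def IsCoherentModule (A : Type*) [CommRing A] (M : Type*) [AddCommGroup M] [Module A M] : Prop :=
  Module.Finite A M ∧ ∀ N : Submodule A M, N.FG → Module.FinitePresentation A N

/-- A ring is coherent if it is coherent as a module over itself. -/
def IsCoherentRing (A : Type*) [CommRing A] : Prop :=
  IsCoherentModule A A

/-! ## Strict modules, systems of parameters, balanced big Cohen-Macaulay modules -/

/-- A module `M` over a local ring `(R, 𝔪)` is strict if `M ≠ 𝔪 M`. -/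
def IsStrict (R : Type*) [CommRing R] [IsLocalRing R] (M : Type*) [AddCommGroup M] [Module R M] :
    Prop :=
  IsLocalRing.maximalIdeal R • (⊤ : Submodule R M) ≠ ⊤

/-- `x₁, …, x_d` is a system of parameters of the local ring `(R, 𝔪)`: `d = dim R`, and `𝔪` is the
radical of the ideal `(x₁, …, x_d)`. -/
def IsSystemOfParameters {R : Type*} [CommRing R] [IsLocalRing R] {d : ℕ} (x : Fin d → R) : Prop :=
  ringKrullDim R = d ∧ (Ideal.span (Set.range x)).radical = IsLocalRing.maximalIdeal R

/-- A strict module is balanced big Cohen-Macaulay if every system of parameters of `R` is a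
regular sequence on it (including `M / (x) M ≠ 0`). -/
def IsBalancedBigCohenMacaulay (R : Type*) [CommRing R] [IsLocalRing R]
    (M : Type*) [AddCommGroup M] [Module R M] : Prop :=
  IsStrict R M ∧ ∀ (d : ℕ) (x : Fin d → R), IsSystemOfParameters x →
    RingTheory.Sequence.IsRegular M (List.ofFn x)

/-! ## Colon quotients -/

/-- The ideal `(x₁, …, x_{i-1})`; with indices starting at `0`, it is generated by the `x j` with
`j < i`. -/
def initialIdeal {A : Type*} [CommRing A] {d : ℕ} (x : Fin d → A) (i : Fin d) : Ideal A :=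
  Ideal.span (x '' {j | j < i})

/-- The module `((x₁, …, x_{i-1}) : x_i) / (x₁, …, x_{i-1})`. -/
abbrev ColonQuotient {A : Type*} [CommRing A] {d : ℕ} (x : Fin d → A) (i : Fin d) : Type _ :=
  ↥((initialIdeal x i).colon {x i}) ⧸
    (initialIdeal x i).submoduleOf ((initialIdeal x i).colon {x i})

/-! ## Signs -/

/-- The sign `(-1) ^ #{t ∈ S | t < s}`. -/
def alternatingSign (A : Type*) [CommRing A] {n : ℕ} (S : Finset (Fin n)) (s : Fin n) : A :=
  (-1) ^ (S.filter (· < s)).card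

theorem alternatingSign_mul_insert {A : Type*} [CommRing A] {n : ℕ} (S : Finset (Fin n))
    {s t : Fin n} (hs : s ∉ S) (ht : t ∉ S) (h : s ≠ t) :
    alternatingSign A S s * alternatingSign A (insert s S) t =
      -(alternatingSign A S t * alternatingSign A (insert t S) s) := by
  unfold alternatingSign
  rw [Finset.filter_insert, Finset.filter_insert]
  rcases lt_or_gt_of_ne h with h | h
  · rw [if_pos h, if_neg h.not_gt, Finset.card_insert_of_notMem (by simp [hs])]
    ring
  · rw [if_neg h.not_gt, if_pos h, Finset.card_insert_of_notMem (by simp [ht])]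
    ring

/-! ## The Koszul complex and its homology -/

section Koszul

variable {A : Type u} [CommRing A] {n : ℕ} (x : Fin n → A) (M : Type w) [AddCommGroup M]
  [Module A M]

/-- The degree `i` part `K_i(x; M) = ⋀ⁱ(Aⁿ) ⊗ M` of the Koszul complex.  A family `f` stands for
`∑ e_S ⊗ f S`, where `e_S = e_{s₁} ∧ … ∧ e_{s_i}` for `S = {s₁ < … < s_i}`. -/
abbrev KoszulChain (n i : ℕ) (M : Type w) : Type w :=
  {S : Finset (Fin n) // S.card = i} → M

/-- The Koszul differential `K_{i+1}(x; M) → K_i(x; M)`,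
`e_{s₀} ∧ … ∧ e_{s_i} ⊗ m ↦ ∑ k, (-1) ^ k e_{s₀} ∧ … ê_{s_k} … ∧ e_{s_i} ⊗ x_{s_k} m`. -/
def koszulD (i : ℕ) : KoszulChain n (i + 1) M →ₗ[A] KoszulChain n i M :=
  LinearMap.pi fun S => ∑ s : {s : Fin n // s ∉ S.1},
    (alternatingSign A S.1 s * x s) •
      LinearMap.proj ⟨insert s.1 S.1, by rw [Finset.card_insert_of_notMem s.2, S.2]⟩

/-- The Koszul differentials compose to zero. -/
theorem koszulD_koszulD (i : ℕ) (f : KoszulChain n (i + 2) M) :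
    koszulD x M i (koszulD x M (i + 1) f) = 0 := by
  ext S
  simp only [koszulD, LinearMap.pi_apply, LinearMap.sum_apply, LinearMap.smul_apply,
    LinearMap.proj_apply, Finset.smul_sum, Pi.zero_apply, Finset.sum_sigma']
  refine Finset.sum_involution
    (fun p _ => ⟨⟨p.2.1, fun h => p.2.2 (Finset.mem_insert_of_mem h)⟩,
      ⟨p.1.1, fun h => (Finset.mem_insert.mp h).elim
        (fun h => p.2.2 (Finset.mem_insert.mpr (Or.inl h.symm))) p.1.2⟩⟩) ?_ ?_ ?_ ?_
  · rintro ⟨⟨s, hs⟩, ⟨t, ht⟩⟩ -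
    have hst : s ≠ t := fun h => ht (Finset.mem_insert.mpr (Or.inl h.symm))
    have ht' : t ∉ S.1 := fun h => ht (Finset.mem_insert_of_mem h)
    have key : ∀ (U V : {S : Finset (Fin n) // S.card = i + 2}), U.1 = V.1 → f U = f V :=
      fun U V h => congrArg f (Subtype.ext h)
    simp only [smul_smul]
    rw [key ⟨insert s (insert t S.1), _⟩ ⟨insert t (insert s S.1), by
        rw [Finset.card_insert_of_notMem ht, Finset.card_insert_of_notMem hs, S.2]⟩
      (Finset.insert_comm _ _ _)]
    rw [← add_smul]
    convert zero_smul A _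
    linear_combination (x s * x t) * alternatingSign_mul_insert (A := A) S.1 hs ht' hst
  · rintro ⟨⟨s, hs⟩, ⟨t, ht⟩⟩ - - h
    have h1 : t = s := congrArg (fun p => p.1.1) h
    exact ht (Finset.mem_insert.mpr (Or.inl h1))
  · simp
  · simp

/-- The cycles of degree `i` of the Koszul complex. -/
def koszulCycles : (i : ℕ) → Submodule A (KoszulChain n i M)
  | 0 => ⊤
  | i + 1 => LinearMap.ker (koszulD x M i)

/-- The Koszul homology module `H_i(x; M)`. -/
abbrev KoszulHomology (i : ℕ) : Type w :=
  ↥(koszulCycles x M i) ⧸ (LinearMap.range (koszulD x M i)).submoduleOf (koszulCycles x M i)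

end Koszul

/-! ## The Čech complex and local cohomology -/

section Cech

variable {A : Type u} [CommRing A] {n : ℕ} (y : Fin n → A) (M : Type w) [AddCommGroup M]
  [Module A M]

/-- The localization `M_a` of `M` at the powers of `a`. -/
abbrev AwayModule (a : A) : Type (max u w) :=
  LocalizedModule (Submonoid.powers a) M

/-- The canonical map `M_a → M_b` for `a ∣ b`. -/
noncomputable def awayMap {a b : A} (h : a ∣ b) : AwayModule M a →ₗ[A] AwayModule M b :=
  LocalizedModule.lift (Submonoid.powers a) (LocalizedModule.mkLinearMap (Submonoid.powers b) M)
    (by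
      rintro ⟨_, k, rfl⟩
      obtain ⟨c, rfl⟩ := h
      have hb := IsLocalizedModule.map_units
        (LocalizedModule.mkLinearMap (Submonoid.powers (a * c)) M)
        (⟨(a * c) ^ k, k, rfl⟩ : Submonoid.powers (a * c))
      simp only [mul_pow, map_mul] at hb
      exact (((Commute.all (a ^ k) (c ^ k)).map (algebraMap A _)).isUnit_mul_iff.mp hb).1)

theorem awayMap_awayMap {a b c : A} (h : a ∣ b) (h' : b ∣ c) (m : AwayModule M a) :
    awayMap M h' (awayMap M h m) = awayMap M (h.trans h') m := by
  have : awayMap M h' ∘ₗ awayMap M h = awayMap M (h.trans h') := by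
    apply IsLocalizedModule.ext (Submonoid.powers a) (LocalizedModule.mkLinearMap _ M)
    · rintro ⟨_, k, rfl⟩
      obtain ⟨d, rfl⟩ := h.trans h'
      have hb := IsLocalizedModule.map_units
        (LocalizedModule.mkLinearMap (Submonoid.powers (a * d)) M)
        (⟨(a * d) ^ k, k, rfl⟩ : Submonoid.powers (a * d))
      simp only [mul_pow, map_mul] at hb
      exact (((Commute.all (a ^ k) (d ^ k)).map (algebraMap A _)).isUnit_mul_iff.mp hb).1
    · ext m
      simp [awayMap]
  exact LinearMap.congr_fun this m

/-- The degree `i` part `∏_{s₁ < … < s_i} M_{y_{s₁} ⋯ y_{s_i}}` of the Čech complex of `M` with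
respect to `y`. -/
abbrev CechCochain (i : ℕ) : Type (max u w) :=
  (S : {S : Finset (Fin n) // S.card = i}) → AwayModule M (∏ s ∈ S.1, y s)

/-- The Čech differential: the component of `d f` at `S = {s₀ < … < s_i}` is
`∑ k, (-1) ^ k` times the image of `f (S \ {s_k})` under localization. -/
noncomputable def cechD (i : ℕ) : CechCochain y M i →ₗ[A] CechCochain y M (i + 1) :=
  LinearMap.pi fun S => ∑ s : {s : Fin n // s ∈ S.1},
    alternatingSign A S.1 s •
      (awayMap M (Finset.prod_dvd_prod_of_subset _ _ y (Finset.erase_subset s.1 S.1)) ∘ₗ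
        LinearMap.proj (φ := fun S : {S : Finset (Fin n) // S.card = i} =>
            AwayModule M (∏ s ∈ S.1, y s))
          ⟨S.1.erase s.1, by rw [Finset.card_erase_of_mem s.2, S.2, Nat.add_sub_cancel]⟩)

/-- The Čech differentials compose to zero. -/
theorem cechD_cechD (i : ℕ) (f : CechCochain y M i) :
    cechD y M (i + 1) (cechD y M i f) = 0 := by
  ext S
  simp only [cechD, LinearMap.pi_apply, LinearMap.sum_apply, LinearMap.smul_apply,
    LinearMap.proj_apply, Finset.smul_sum, Pi.zero_apply, LinearMap.comp_apply, map_sum, map_smul,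
    awayMap_awayMap, Finset.sum_sigma']
  refine Finset.sum_involution
    (fun p _ => ⟨⟨p.2.1, Finset.mem_of_mem_erase p.2.2⟩,
      ⟨p.1.1, Finset.mem_erase.mpr ⟨fun h => by simpa [h] using p.2.2, p.1.2⟩⟩⟩) ?_ ?_ ?_ ?_
  · rintro ⟨⟨s, hs⟩, ⟨t, ht⟩⟩ -
    have hst : s ≠ t := fun h => by simp [h] at ht
    have ht' : t ∈ S.1 := Finset.mem_of_mem_erase ht
    have key : ∀ (U V : {S : Finset (Fin n) // S.card = i}) (h : U = V)
      (hU : ∏ s ∈ U.1, y s ∣ ∏ s ∈ S.1, y s) (hV : ∏ s ∈ V.1, y s ∣ ∏ s ∈ S.1, y s),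
      awayMap M hU (f U) = awayMap M hV (f V) := by
      rintro U _ rfl _ _; rfl
    simp only [smul_smul]
    rw [key ⟨(S.1.erase t).erase s, _⟩ ⟨(S.1.erase s).erase t, by
        rw [Finset.card_erase_of_mem ht, Finset.card_erase_of_mem hs, S.2]; rfl⟩
      (Subtype.ext (Finset.erase_right_comm)) _
      (Finset.prod_dvd_prod_of_subset _ _ y ((Finset.erase_subset _ _).trans
        (Finset.erase_subset _ _))), ← add_smul]
    convert zero_smul A _
    have := alternatingSign_mul_insert (A := A) ((S.1.erase s).erase t) (s := s) (t := t) (by simp) (by simp) hst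
    have e1 : insert s ((S.1.erase s).erase t) = S.1.erase t := by
      rw [Finset.erase_right_comm, Finset.insert_erase (by simp [hst, hs])]
    have e2 : insert t ((S.1.erase s).erase t) = S.1.erase s := by
      rw [Finset.insert_erase (by simp [hst.symm, ht'])]
    have h1 : ∀ (U : Finset (Fin n)) r, alternatingSign A (U.erase r) r = alternatingSign A U r := by
      intro U r
      unfold alternatingSign
      congr 2; ext q; simp; grind
    rw [e1, e2, h1 S.1 s, h1 S.1 t, h1 (S.1.erase s) t, Finset.erase_right_comm, h1] at this
    linear_combination this
  · rintro ⟨⟨s, hs⟩, ⟨t, ht⟩⟩ - - h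
    simp only [Sigma.mk.injEq, Subtype.mk.injEq] at h
    simp [h.1] at ht
  · simp
  · simp

/-- The coboundaries of degree `i` of the Čech complex. -/
noncomputable def cechCoboundaries : (i : ℕ) → Submodule A (CechCochain y M i)
  | 0 => ⊥
  | i + 1 => LinearMap.range (cechD y M i)

/-- The `i`-th cohomology of the Čech complex of `M` with respect to `y`, which is the local
cohomology module of `M` with support in the ideal `(y₁, …, y_n)` (up to isomorphism, it
depends only on the radical of that ideal). -/
abbrev CechCohomology (i : ℕ) : Type (max u w) :=
  ↥(LinearMap.ker (cechD y M i)) ⧸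
    (cechCoboundaries y M i).submoduleOf (LinearMap.ker (cechD y M i))

end Cech

/-! ## Almost closures -/

section AlmostClosure

variable {T : Type*} [CommRing T] {v : ValueMap T}

/-! Since `v` is additive on products and `v 1 = 0`, the elements that scalars of arbitrarily small
value multiply into a submodule `N` form a submodule, `almostClosure hv N`, and forming it twice
adds nothing. Almost zero modules are therefore closed under submodules, quotients and extensions,
and long exact sequences can be used up to almost zero error, element by element.

For (a) ⇒ (b), the Koszul complex on `k + 1` elements is the mapping cone of multiplication by the
last one on the complex on the first `k`. Induction on `k` reduces everything to degree one, where
the obstruction is exactly the colon quotient (`initialCycles_le_almostClosure`).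

For the rest, write `B_i ⊆ Z_i ⊆ K_i` for the boundaries, cycles and chains of the Koszul complex,
and split it into `0 → Z_{i+1} → K_{i+1} → B_i → 0` and `0 → B_i → Z_i → H_i → 0`. The Čech complex
is exact in the coefficient module, so these sequences shift cohomological degree.

For (b) ⇒ (c), let `r < d` be a degree below which Čech cohomology is almost zero. A class in degree
`r` is killed by powers of the parameters; these powers are again a system of parameters, so the
class may be assumed killed by the sequence itself. The top Koszul differential has entries `± x_s`
and so kills it, yet by dimension shifting it is almost injective on degree `r` cohomology
(`mem_almostClosure_of_koszulHomology`).

For (c), descending induction along the Koszul complex gives that positive Koszul homology is almost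
zero (`koszulHomology_almostZero_of_cech`). Over a coherent ring with normalized `v`, finitely
generated submodules of finite free modules are almost closed (`IsCoherentRing.almostClosure_le`),
so `H_1` vanishes exactly. Nakayama's lemma passes this vanishing to initial segments
(`initialCycles_one_le_of_le`), which makes the sequence regular. -/

theorem ValueMap.map_one_of_ne_top (hv : ∃ b : T, v b ≠ ⊤) : v 1 = 0 := by
  obtain ⟨b, hb⟩ := hv
  have h := v.map_mul' 1 b
  rw [one_mul] at h
  exact (WithTop.add_right_cancel (z := v b) hb (by rw [zero_add]; exact h)).symm

theorem ValueMap.mul_lt_of_lt_half {a b : T} {ε : ℝ} (ha : v a < ((ε / 2 : ℝ) : WithTop ℝ))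
    (hb : v b < ((ε / 2 : ℝ) : WithTop ℝ)) : v (a * b) < (ε : WithTop ℝ) := by
  have h := v.map_mul' a b
  rw [show v (a * b) = v a + v b from h]
  calc v a + v b < ((ε / 2 : ℝ) : WithTop ℝ) + ((ε / 2 : ℝ) : WithTop ℝ) :=
        WithTop.add_lt_add ha hb
    _ = ε := by rw [← WithTop.coe_add, add_halves]

variable (hv : v 1 = 0)

/-- The elements that elements of arbitrarily small value multiply into `N`. -/
def almostClosure {M : Type*} [AddCommGroup M] [Module T M] (N : Submodule T M) :
    Submodule T M where
  carrier := {m | ∀ ε : ℝ, 0 < ε → ∃ b : T, v b < (ε : WithTop ℝ) ∧ b • m ∈ N}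
  zero_mem' := fun ε hε => ⟨1, by rw [hv]; exact_mod_cast hε, by simp⟩
  add_mem' := by
    intro m m' hm hm' ε hε
    obtain ⟨b, hb, hbm⟩ := hm (ε / 2) (half_pos hε)
    obtain ⟨c, hc, hcm⟩ := hm' (ε / 2) (half_pos hε)
    refine ⟨b * c, ValueMap.mul_lt_of_lt_half hb hc, ?_⟩
    rw [smul_add]
    refine N.add_mem ?_ ?_
    · rw [mul_comm, mul_smul]; exact N.smul_mem _ hbm
    · rw [mul_smul]; exact N.smul_mem _ hcm
  smul_mem' := by
    intro a m hm ε hε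
    obtain ⟨b, hb, hbm⟩ := hm ε hε
    exact ⟨b, hb, by rw [smul_comm]; exact N.smul_mem _ hbm⟩

variable {M M' : Type*} [AddCommGroup M] [Module T M] [AddCommGroup M'] [Module T M']

theorem mem_almostClosure {N : Submodule T M} {m : M} :
    m ∈ almostClosure hv N ↔ ∀ ε : ℝ, 0 < ε → ∃ b : T, v b < (ε : WithTop ℝ) ∧ b • m ∈ N :=
  Iff.rfl

theorem le_almostClosure (N : Submodule T M) : N ≤ almostClosure hv N :=
  fun _ hm ε hε => ⟨1, by rw [hv]; exact_mod_cast hε, by simpa using hm⟩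

theorem almostClosure_mono {N N' : Submodule T M} (h : N ≤ N') :
    almostClosure hv N ≤ almostClosure hv N' :=
  fun _ hm ε hε => let ⟨b, hb, hbm⟩ := hm ε hε; ⟨b, hb, h hbm⟩

/-- An element is in the almost closure if elements of arbitrarily small value multiply it into
the almost closure. -/
theorem mem_almostClosure_of_smul_mem {N : Submodule T M} {m : M}
    (h : ∀ ε : ℝ, 0 < ε → ∃ b : T, v b < (ε : WithTop ℝ) ∧ b • m ∈ almostClosure hv N) :
    m ∈ almostClosure hv N := by
  intro ε hε
  obtain ⟨b, hb, hbm⟩ := h (ε / 2) (half_pos hε)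
  obtain ⟨c, hc, hcm⟩ := hbm (ε / 2) (half_pos hε)
  exact ⟨c * b, ValueMap.mul_lt_of_lt_half hc hb, by rwa [mul_smul]⟩

theorem map_mem_almostClosure (f : M →ₗ[T] M') {N : Submodule T M} {N' : Submodule T M'}
    (h : N ≤ N'.comap f) {m : M} (hm : m ∈ almostClosure hv N) :
    f m ∈ almostClosure hv N' :=
  fun ε hε => let ⟨b, hb, hbm⟩ := hm ε hε; ⟨b, hb, by rw [← map_smul]; exact h hbm⟩

theorem isAlmostZero_iff : IsAlmostZero v M ↔ ∀ m : M, m ∈ almostClosure hv (⊥ : Submodule T M) := by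
  simp only [IsAlmostZero, mem_almostClosure, Submodule.mem_bot, and_comm]

/-- Turns almost vanishing of a homology module into an inclusion of submodules of chains, so that
later arguments work with cycles and boundaries instead of quotient classes. -/
theorem isAlmostZero_quotient_iff (K N : Submodule T M) :
    IsAlmostZero v (↥K ⧸ N.submoduleOf K) ↔ K ≤ almostClosure hv N := by
  constructor
  · intro h m hm ε hε
    obtain ⟨b, hb, hbv⟩ := h (Submodule.Quotient.mk ⟨m, hm⟩) ε hε
    refine ⟨b, hbv, ?_⟩
    rw [← Submodule.Quotient.mk_smul, Submodule.Quotient.mk_eq_zero] at hb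
    exact hb
  · intro h m ε hε
    obtain ⟨m, rfl⟩ := Submodule.Quotient.mk_surjective _ m
    obtain ⟨b, hb, hbm⟩ := h m.2 ε hε
    refine ⟨b, ?_, hb⟩
    rw [← Submodule.Quotient.mk_smul, Submodule.Quotient.mk_eq_zero]
    exact hbm

end AlmostClosure

/-! ## Coherent rings -/

section Coherent

variable {T : Type w} [CommRing T]

/-- Project `N` to its first coordinate: the image is a finitely generated ideal, hence finitely
presented, so the kernel is finitely generated. The kernel embeds in `T^n`, induction applies to it,
and finite presentation is stable under extensions. -/
theorem IsCoherentRing.finitePresentation_of_fg_pi (hT : IsCoherentRing T) (n : ℕ)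
    (N : Submodule T (Fin n → T)) (hN : N.FG) : Module.FinitePresentation T N := by
  induction n with
  | zero =>
    have : Subsingleton N := inferInstance
    exact Module.finitePresentation_of_projective T N
  | succ n ih =>
    have : Module.Finite T N := Module.Finite.iff_fg.mpr hN
    let p : N →ₗ[T] T := LinearMap.proj 0 ∘ₗ N.subtype
    have : Module.FinitePresentation T (LinearMap.range p) :=
      hT.2 _ (Module.Finite.iff_fg.mp inferInstance)
    have hker : (LinearMap.ker p.rangeRestrict).FG :=
      Module.FinitePresentation.fg_ker _ p.surjective_rangeRestrict
    let t : ↥(LinearMap.ker p.rangeRestrict) →ₗ[T] (Fin n → T) :=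
      LinearMap.funLeft T T Fin.succ ∘ₗ N.subtype ∘ₗ (LinearMap.ker p.rangeRestrict).subtype
    have ht : Function.Injective t := by
      intro a b hab
      ext j
      refine Fin.cases ?_ (fun j => congrFun hab j) j
      have ha := congrArg Subtype.val a.2
      have hb := congrArg Subtype.val b.2
      exact ha.trans hb.symm
    have : Module.Finite T ↥(LinearMap.ker p.rangeRestrict) := Module.Finite.iff_fg.mpr hker
    have hr := ih (LinearMap.range t) (Module.Finite.iff_fg.mp inferInstance)
    have : Module.FinitePresentation T ↥(LinearMap.ker p.rangeRestrict) :=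
      (LinearEquiv.finitePresentation_iff
        (M := ↥(LinearMap.ker p.rangeRestrict)) (LinearEquiv.ofInjective t ht)).mpr hr
    exact Module.finitePresentation_of_ker _ p.surjective_rangeRestrict

theorem IsCoherentRing.finitePresentation_of_fg (hT : IsCoherentRing T) {ι : Type*} [Finite ι]
    (N : Submodule T (ι → T)) (hN : N.FG) : Module.FinitePresentation T N := by
  obtain ⟨n, ⟨e⟩⟩ := Finite.exists_equiv_fin ι
  let f : (ι → T) ≃ₗ[T] (Fin n → T) := LinearEquiv.funCongrLeft T T e.symm
  have := hT.finitePresentation_of_fg_pi n (N.map f.toLinearMap) (hN.map _)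
  exact Module.FinitePresentation.of_equiv (f.submoduleMap N).symm

/-- Over a coherent ring, the kernel of a map between finite free modules meets finitely generated
submodules in finitely generated submodules. -/
theorem IsCoherentRing.fg_inf_ker (hT : IsCoherentRing T) {ι κ : Type*} [Finite κ]
    (P : Submodule T (ι → T)) (hP : P.FG) (f : (ι → T) →ₗ[T] (κ → T)) :
    (P ⊓ LinearMap.ker f).FG := by
  have : Module.Finite T P := Module.Finite.iff_fg.mpr hP
  let g : P →ₗ[T] (κ → T) := f ∘ₗ P.subtype
  have := hT.finitePresentation_of_fg (LinearMap.range g) (Module.Finite.iff_fg.mp inferInstance)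
  have hker : (LinearMap.ker g.rangeRestrict).FG :=
    Module.FinitePresentation.fg_ker _ g.surjective_rangeRestrict
  convert hker.map P.subtype
  ext m
  simp [g, and_comm]

/-- Over a coherent ring with a normalized value map, finitely generated submodules of finite free
modules are almost closed. -/
theorem IsCoherentRing.almostClosure_le (hT : IsCoherentRing T) {v : ValueMap T} (hv : v 1 = 0)
    (hn : v.IsNormalized) {ι : Type*} [Finite ι] (N : Submodule T (ι → T)) (hN : N.FG) :
    almostClosure hv N ≤ N := by
  intro m hm
  have : Module.Finite T N := Module.Finite.iff_fg.mpr hN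
  -- the ideal of multipliers of `m` into `N` is finitely generated
  let g : (T × N) →ₗ[T] (ι → T) :=
    (LinearMap.toSpanSingleton T _ m).coprod N.subtype
  have := hT.finitePresentation_of_fg (LinearMap.range g) (Module.Finite.iff_fg.mp inferInstance)
  have hker : (LinearMap.ker g.rangeRestrict).FG :=
    Module.FinitePresentation.fg_ker _ g.surjective_rangeRestrict
  let I : Ideal T := N.comap (LinearMap.toSpanSingleton T _ m)
  have hI : I.FG := by
    -- The kernel of `g` is the module of relations `a • m + n = 0` with `n` in `N`; its first
    -- coordinates are the multipliers.
    suffices e : I = (LinearMap.ker g.rangeRestrict).map (LinearMap.fst T T N) by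
      rw [e]; exact hker.map _
    ext a
    simp only [I, Submodule.mem_comap, Submodule.mem_map, LinearMap.mem_ker, Prod.exists,
      Subtype.ext_iff, g, LinearMap.fst_apply]
    constructor
    · intro h
      exact ⟨a, -⟨_, h⟩, by simp, rfl⟩
    · rintro ⟨a, n, h, rfl⟩
      have h' : a • m + n.1 = 0 := h
      have : a • m = -n.1 := eq_neg_of_add_eq_zero_left h'
      simp [this]
  obtain ⟨s, hs⟩ := hI
  by_cases h1 : (1 : T) ∈ I
  · simpa [I] using h1
  exfalso
  have hpos : ∀ a ∈ I, 0 < v a := fun a ha => hn.2 a fun hu => h1 (by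
    rw [Ideal.eq_top_of_isUnit_mem _ ha hu]; trivial)
  -- If the multiplier ideal is proper, its finitely many generators are non-units, so their values
  -- have a positive lower bound (an infinite value is bounded by `1`). As `v` is nonnegative, the
  -- bound extends to the whole ideal, contradicting the choice of `m`.
  obtain ⟨ε, hε, hεs⟩ : ∃ ε : ℝ, 0 < ε ∧ ∀ a ∈ s, (ε : WithTop ℝ) ≤ v a := by
    have hsI : ∀ a ∈ s, 0 < v a := fun a ha => hpos a (hs ▸ Submodule.subset_span ha)
    clear hs
    classical
    induction s using Finset.induction_on with
    | empty => exact ⟨1, one_pos, by simp⟩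
    | insert a s _ ih =>
      obtain ⟨ε, hε, h⟩ := ih fun b hb => hsI b (Finset.mem_insert_of_mem hb)
      have ha := hsI a (Finset.mem_insert_self _ _)
      obtain ⟨δ, hδ, h'⟩ : ∃ δ : ℝ, 0 < δ ∧ (δ : WithTop ℝ) ≤ v a := by
        cases hva : v a with
        | top => exact ⟨1, one_pos, le_top⟩
        | coe r => exact ⟨r, by rw [hva] at ha; exact_mod_cast ha, le_rfl⟩
      refine ⟨min ε δ, lt_min hε hδ, fun b hb => ?_⟩
      rcases Finset.mem_insert.mp hb with rfl | hb
      · exact le_trans (by exact_mod_cast min_le_right _ _) h'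
      · exact le_trans (by exact_mod_cast min_le_left _ _) (h b hb)
  have hεI : ∀ a ∈ I, (ε : WithTop ℝ) ≤ v a := by
    intro a ha
    rw [← hs] at ha
    refine Submodule.span_induction (p := fun a _ => (ε : WithTop ℝ) ≤ v a)
      (fun a ha => hεs a ha) ?_ ?_ ?_ ha
    · rw [show v 0 = ⊤ from v.map_zero']; exact le_top
    · intro a b _ _ ha hb
      exact (le_min ha hb).trans (v.min_le_map_add' a b)
    · intro c a _ ha
      rw [smul_eq_mul, show v (c * a) = v c + v a from v.map_mul' c a]
      exact ha.trans (le_add_of_nonneg_left (hn.1 c))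
  obtain ⟨b, hb, hbm⟩ := hm ε hε
  exact (hb.trans_le (hεI b hbm)).false

end Coherent

/-! ## Functoriality and exactness of the Čech complex -/

section CechFunctoriality

variable {A : Type u} [CommRing A] {n : ℕ} (y : Fin n → A)
  {M N P : Type w} [AddCommGroup M] [Module A M] [AddCommGroup N] [Module A N]
  [AddCommGroup P] [Module A P]

theorem isUnit_algebraMap_end_awayModule (M : Type w) [AddCommGroup M] [Module A M] {a b : A}
    (h : a ∣ b) (x : Submonoid.powers a) :
    IsUnit (algebraMap A (Module.End A (AwayModule M b)) x) := by
  obtain ⟨_, k, rfl⟩ := x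
  obtain ⟨c, rfl⟩ := h
  have hb := IsLocalizedModule.map_units
    (LocalizedModule.mkLinearMap (Submonoid.powers (a * c)) M)
    (⟨(a * c) ^ k, k, rfl⟩ : Submonoid.powers (a * c))
  simp only [mul_pow, map_mul] at hb
  exact (((Commute.all (a ^ k) (c ^ k)).map (algebraMap A _)).isUnit_mul_iff.mp hb).1

/-- The map on localizations at the powers of `a` induced by a linear map. -/
noncomputable abbrev awayModuleMap (a : A) (f : M →ₗ[A] N) : AwayModule M a →ₗ[A] AwayModule N a :=
  IsLocalizedModule.map (Submonoid.powers a) (LocalizedModule.mkLinearMap (Submonoid.powers a) M)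
    (LocalizedModule.mkLinearMap (Submonoid.powers a) N) f

theorem awayMap_mkLinearMap {a b : A} (h : a ∣ b) (m : M) :
    awayMap M h (LocalizedModule.mkLinearMap (Submonoid.powers a) M m) =
      LocalizedModule.mkLinearMap (Submonoid.powers b) M m := by
  simp [awayMap]

theorem awayMap_awayModuleMap {a b : A} (h : a ∣ b) (f : M →ₗ[A] N) (m : AwayModule M a) :
    awayMap N h (awayModuleMap a f m) = awayModuleMap b f (awayMap M h m) := by
  have : awayMap N h ∘ₗ awayModuleMap a f = awayModuleMap b f ∘ₗ awayMap M h := by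
    apply IsLocalizedModule.ext (Submonoid.powers a) (LocalizedModule.mkLinearMap _ M)
      (isUnit_algebraMap_end_awayModule N h)
    ext m
    rw [LinearMap.comp_apply, LinearMap.comp_apply, LinearMap.comp_apply, LinearMap.comp_apply,
      awayMap_mkLinearMap, IsLocalizedModule.map_apply, IsLocalizedModule.map_apply,
      awayMap_mkLinearMap]
  exact LinearMap.congr_fun this m

/-- The map of Čech complexes induced by a linear map. -/
noncomputable def cechMap (f : M →ₗ[A] N) (q : ℕ) : CechCochain y M q →ₗ[A] CechCochain y N q :=
  LinearMap.pi fun S => awayModuleMap _ f ∘ₗ LinearMap.proj S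

theorem cechMap_apply (f : M →ₗ[A] N) (q : ℕ) (z : CechCochain y M q) (S) :
    cechMap y f q z S = awayModuleMap _ f (z S) := rfl

theorem cechD_cechMap (f : M →ₗ[A] N) (q : ℕ) (z : CechCochain y M q) :
    cechD y N q (cechMap y f q z) = cechMap y f (q + 1) (cechD y M q z) := by
  ext1 S
  rw [cechMap_apply]
  simp only [cechD, LinearMap.pi_apply, LinearMap.sum_apply, LinearMap.smul_apply,
    LinearMap.proj_apply, LinearMap.comp_apply, map_sum, map_smul]
  exact Finset.sum_congr rfl fun s _ => congrArg _ (awayMap_awayModuleMap _ f _)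

theorem cechMap_injective {f : M →ₗ[A] N} (hf : Function.Injective f) (q : ℕ) :
    Function.Injective (cechMap y f q) := fun a b hab => by
  ext1 S
  exact IsLocalizedModule.map_injective _ _ _ f hf (congrFun hab S)

theorem cechMap_surjective {f : M →ₗ[A] N} (hf : Function.Surjective f) (q : ℕ) :
    Function.Surjective (cechMap y f q) := fun b => by
  have key : ∀ S, ∃ a, awayModuleMap (∏ s ∈ S.1, y s) f a = b S := fun S =>
    IsLocalizedModule.map_surjective _ _ _ f hf (b S)
  choose a ha using key
  exact ⟨a, funext ha⟩

theorem cechMap_exact {f : M →ₗ[A] N} {g : N →ₗ[A] P} (h : Function.Exact f g) (q : ℕ) :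
    Function.Exact (cechMap y f q) (cechMap y g q) := by
  intro b
  have key := fun S : {S : Finset (Fin n) // S.card = q} => IsLocalizedModule.map_exact
    (Submonoid.powers (∏ s ∈ S.1, y s)) (LocalizedModule.mkLinearMap (Submonoid.powers (∏ s ∈ S.1, y s)) M)
    (LocalizedModule.mkLinearMap (Submonoid.powers (∏ s ∈ S.1, y s)) N) (LocalizedModule.mkLinearMap (Submonoid.powers (∏ s ∈ S.1, y s)) P) f g h (b S)
  constructor
  · intro hb
    choose a ha using fun S => (key S).mp (congrFun hb S)
    exact ⟨a, funext ha⟩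
  · rintro ⟨a, rfl⟩
    ext1 S
    exact (key S).mpr ⟨a S, rfl⟩

theorem cechMap_mem_cechCoboundaries (f : M →ₗ[A] N) (q : ℕ) :
    cechCoboundaries y M q ≤ (cechCoboundaries y N q).comap (cechMap y f q) := by
  cases q with
  | zero => simp [cechCoboundaries]
  | succ q =>
    rintro _ ⟨w, rfl⟩
    exact ⟨cechMap y f q w, cechD_cechMap y f q w⟩

theorem cechCoboundaries_le_map {g : N →ₗ[A] P} (hg : Function.Surjective g) (q : ℕ) :
    cechCoboundaries y P q ≤ (cechCoboundaries y N q).map (cechMap y g q) := by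
  cases q with
  | zero => simp [cechCoboundaries]
  | succ q =>
    rintro _ ⟨w, rfl⟩
    obtain ⟨w, rfl⟩ := cechMap_surjective y hg q w
    exact ⟨_, ⟨w, rfl⟩, (cechD_cechMap y g q w).symm⟩

theorem cechCoboundaries_le_ker (q : ℕ) :
    cechCoboundaries y N q ≤ LinearMap.ker (cechD y N q) := by
  cases q with
  | zero => simp [cechCoboundaries]
  | succ q =>
    rintro _ ⟨w, rfl⟩
    exact cechD_cechD y N q w

theorem cechMap_mem_ker (f : M →ₗ[A] N) {q : ℕ} {z : CechCochain y M q}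
    (hz : z ∈ LinearMap.ker (cechD y M q)) : cechMap y f q z ∈ LinearMap.ker (cechD y N q) := by
  rw [LinearMap.mem_ker, cechD_cechMap, LinearMap.mem_ker.mp hz, map_zero]

theorem mem_ker_of_cechMap_mem_ker {f : M →ₗ[A] N} (hf : Function.Injective f) {q : ℕ}
    {z : CechCochain y M q} (hz : cechMap y f q z ∈ LinearMap.ker (cechD y N q)) :
    z ∈ LinearMap.ker (cechD y M q) := by
  rw [LinearMap.mem_ker, cechD_cechMap] at hz
  exact cechMap_injective y hf (q + 1) (by rw [hz, map_zero])

end CechFunctoriality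

/-! ## Almost vanishing of Čech cohomology -/

section CechAlmostZero

variable {A : Type u} [CommRing A] {v : ValueMap A} (hv : v 1 = 0) {n : ℕ} (y : Fin n → A)
  {M N P : Type w} [AddCommGroup M] [Module A M] [AddCommGroup N] [Module A N]
  [AddCommGroup P] [Module A P]

/-- The Čech cohomology of `M` in degree `q` is almost zero. -/
def CechAlmostZero (M : Type w) [AddCommGroup M] [Module A M] (q : ℕ) : Prop :=
  LinearMap.ker (cechD y M q) ≤ almostClosure hv (cechCoboundaries y M q)

theorem isAlmostZero_cechCohomology_iff (q : ℕ) :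
    IsAlmostZero v (CechCohomology y M q) ↔ CechAlmostZero hv y M q :=
  isAlmostZero_quotient_iff hv _ _

/-- A cocycle of the middle term of a short exact sequence that becomes almost a coboundary in
the last term. -/
theorem mem_almostClosure_of_cechMap_right {f : M →ₗ[A] N} {g : N →ₗ[A] P}
    (hf : Function.Injective f) (hg : Function.Surjective g) (h : Function.Exact f g) {q : ℕ}
    (hM : CechAlmostZero hv y M q) {z : CechCochain y N q}
    (hz : z ∈ LinearMap.ker (cechD y N q))
    (hgz : cechMap y g q z ∈ almostClosure hv (cechCoboundaries y P q)) :
    z ∈ almostClosure hv (cechCoboundaries y N q) := by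
  refine mem_almostClosure_of_smul_mem hv fun ε hε => ?_
  obtain ⟨b, hb, hbz⟩ := hgz ε hε
  obtain ⟨u, hu, hub⟩ := cechCoboundaries_le_map y hg q hbz
  -- Up to the coboundary `u`, the multiple `b • z` comes from a cocycle of `M`, which is almost a
  -- coboundary.
  have h0 : cechMap y g q (b • z - u) = 0 := by rw [map_sub, map_smul, hub, sub_self]
  obtain ⟨t, ht⟩ := (cechMap_exact y h q _).mp h0
  have htk : t ∈ LinearMap.ker (cechD y M q) := mem_ker_of_cechMap_mem_ker y hf (by
    rw [ht]
    exact Submodule.sub_mem _ (Submodule.smul_mem _ _ hz) (cechCoboundaries_le_ker y q hu))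
  refine ⟨b, hb, ?_⟩
  have := map_mem_almostClosure hv (cechMap y f q) (cechMap_mem_cechCoboundaries y f q) (hM htk)
  rw [ht] at this
  simpa using add_mem this (le_almostClosure hv _ hu)

/-- The cohomology of the middle term of a short exact sequence. -/
theorem CechAlmostZero.middle {f : M →ₗ[A] N} {g : N →ₗ[A] P} (hf : Function.Injective f)
    (hg : Function.Surjective g) (h : Function.Exact f g) {q : ℕ}
    (hM : CechAlmostZero hv y M q) (hP : CechAlmostZero hv y P q) : CechAlmostZero hv y N q :=
  fun _ hz => mem_almostClosure_of_cechMap_right hv y hf hg h hM hz (hP (cechMap_mem_ker y g hz))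

/-- The cohomology of the last term of a short exact sequence. -/
theorem CechAlmostZero.right {f : M →ₗ[A] N} {g : N →ₗ[A] P} (hf : Function.Injective f)
    (hg : Function.Surjective g) (h : Function.Exact f g) {q : ℕ}
    (hN : CechAlmostZero hv y N q) (hM : CechAlmostZero hv y M (q + 1)) :
    CechAlmostZero hv y P q := by
  intro z hz
  obtain ⟨w, rfl⟩ := cechMap_surjective y hg q z
  refine mem_almostClosure_of_smul_mem hv fun ε hε => ?_
  rw [LinearMap.mem_ker, cechD_cechMap] at hz
  -- The cocycle `u` represents the connecting homomorphism applied to the class of `z`. Once `b •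
  -- u` bounds `t`, subtracting the image of `t` turns `b • w` into a cocycle lifting `b • z`.
  obtain ⟨u, hu⟩ := (cechMap_exact y h (q + 1) _).mp hz
  have huk : u ∈ LinearMap.ker (cechD y M (q + 1)) := mem_ker_of_cechMap_mem_ker y hf (by
    rw [hu]; exact cechD_cechD y N q w)
  obtain ⟨b, hb, t, ht⟩ := hM huk ε hε
  refine ⟨b, hb, ?_⟩
  have hk : b • w - cechMap y f q t ∈ LinearMap.ker (cechD y N q) := by
    rw [LinearMap.mem_ker, map_sub, map_smul, cechD_cechMap, ht, map_smul, hu, sub_self]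
  have := map_mem_almostClosure hv (cechMap y g q) (cechMap_mem_cechCoboundaries y g q) (hN hk)
  rwa [map_sub, (cechMap_exact y h q _).mpr ⟨t, rfl⟩, sub_zero, map_smul] at this

/-- A cocycle of a submodule that becomes almost a coboundary in degree zero is almost zero. -/
theorem mem_almostClosure_of_cechMap_zero {f : M →ₗ[A] N} (hf : Function.Injective f)
    {z : CechCochain y M 0}
    (hz : cechMap y f 0 z ∈ almostClosure hv (cechCoboundaries y N 0)) :
    z ∈ almostClosure hv (cechCoboundaries y M 0) := by
  intro ε hε
  obtain ⟨b, hb, hbz⟩ := hz ε hε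
  refine ⟨b, hb, cechMap_injective y hf 0 ?_⟩
  rw [map_smul, map_zero]
  exact hbz

/-- A cocycle of the first term of a short exact sequence that becomes almost a coboundary in the
middle term. -/
theorem mem_almostClosure_of_cechMap_succ {f : M →ₗ[A] N} {g : N →ₗ[A] P}
    (hf : Function.Injective f) (hg : Function.Surjective g) (h : Function.Exact f g) {q : ℕ}
    (hP : CechAlmostZero hv y P q) {z : CechCochain y M (q + 1)}
    (hz : cechMap y f (q + 1) z ∈ almostClosure hv (cechCoboundaries y N (q + 1))) :
    z ∈ almostClosure hv (cechCoboundaries y M (q + 1)) := by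
  refine mem_almostClosure_of_smul_mem hv fun ε hε => ?_
  obtain ⟨b, hb, w, hw⟩ := hz ε hε
  refine ⟨b, hb, ?_⟩
  rw [← map_smul] at hw
  -- A primitive `w` of `b • z` in `N` need not come from `M`. Its image in `P` is a cocycle, so
  -- after multiplication by `c` it can be corrected by a coboundary of `N`, which leaves its
  -- differential unchanged.
  have hgw : cechMap y g q w ∈ LinearMap.ker (cechD y P q) := by
    rw [LinearMap.mem_ker, cechD_cechMap, hw]
    exact (cechMap_exact y h (q + 1) _).mpr ⟨_, rfl⟩
  intro δ hδ
  obtain ⟨c, hc, hcw⟩ := hP hgw δ hδ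
  obtain ⟨u, hu, huc⟩ := cechCoboundaries_le_map y hg q hcw
  have h0 : cechMap y g q (c • w - u) = 0 := by rw [map_sub, map_smul, huc, sub_self]
  obtain ⟨t, ht⟩ := (cechMap_exact y h q _).mp h0
  refine ⟨c, hc, t, cechMap_injective y hf (q + 1) ?_⟩
  rw [← cechD_cechMap, ht, map_sub, LinearMap.mem_ker.mp (cechCoboundaries_le_ker y q hu),
    sub_zero, map_smul, hw, map_smul, map_smul, map_smul]

/-- The cohomology of the first term of a short exact sequence. -/
theorem CechAlmostZero.left_succ {f : M →ₗ[A] N} {g : N →ₗ[A] P} (hf : Function.Injective f)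
    (hg : Function.Surjective g) (h : Function.Exact f g) {q : ℕ}
    (hP : CechAlmostZero hv y P q) (hN : CechAlmostZero hv y N (q + 1)) :
    CechAlmostZero hv y M (q + 1) := fun _ hz =>
  mem_almostClosure_of_cechMap_succ hv y hf hg h hP (hN (cechMap_mem_ker y f hz))

theorem CechAlmostZero.left_zero {f : M →ₗ[A] N} (hf : Function.Injective f)
    (hN : CechAlmostZero hv y N 0) : CechAlmostZero hv y M 0 := fun _ hz =>
  mem_almostClosure_of_cechMap_zero hv y hf (hN (cechMap_mem_ker y f hz))

/-- The Čech complex of an almost zero module is almost zero. -/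
theorem mem_almostClosure_bot_of_forall
    (hM : ∀ m : M, m ∈ almostClosure hv (⊥ : Submodule A M)) {q : ℕ} (z : CechCochain y M q) :
    z ∈ almostClosure hv (⊥ : Submodule A (CechCochain y M q)) := by
  rw [← LinearMap.sum_single_apply (φ := fun S : {S : Finset (Fin n) // S.card = q} =>
    AwayModule M (∏ s ∈ S.1, y s)) z]
  refine sum_mem fun S _ => map_mem_almostClosure hv (N := ⊥) (LinearMap.single A
    (fun S : {S : Finset (Fin n) // S.card = q} => AwayModule M (∏ s ∈ S.1, y s)) S) bot_le ?_
  generalize z S = m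
  induction m using LocalizedModule.induction_on with
  | h m s =>
    intro ε hε
    obtain ⟨b, hb, hbm⟩ := hM m ε hε
    refine ⟨b, hb, ?_⟩
    rw [Submodule.mem_bot] at hbm ⊢
    rw [LocalizedModule.smul'_mk, hbm, LocalizedModule.zero_mk]

theorem CechAlmostZero.of_forall (hM : ∀ m : M, m ∈ almostClosure hv (⊥ : Submodule A M))
    (q : ℕ) : CechAlmostZero hv y M q := fun z _ =>
  almostClosure_mono hv bot_le (mem_almostClosure_bot_of_forall hv y hM z)

theorem cechMap_comp (f : M →ₗ[A] N) (g : N →ₗ[A] P) (q : ℕ) (z : CechCochain y M q) :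
    cechMap y (g ∘ₗ f) q z = cechMap y g q (cechMap y f q z) := by
  ext1 S
  rw [cechMap_apply, cechMap_apply, cechMap_apply, awayModuleMap, IsLocalizedModule.map_comp'
    (Submonoid.powers (∏ s ∈ S.1, y s)) (LocalizedModule.mkLinearMap (Submonoid.powers (∏ s ∈ S.1, y s)) M)
    (LocalizedModule.mkLinearMap (Submonoid.powers (∏ s ∈ S.1, y s)) N) (LocalizedModule.mkLinearMap (Submonoid.powers (∏ s ∈ S.1, y s)) P) f g]
  rfl

theorem cechMap_sum {ι : Type*} (s : Finset ι) (f : ι → M →ₗ[A] N) (q : ℕ)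
    (z : CechCochain y M q) :
    cechMap y (∑ i ∈ s, f i) q z = ∑ i ∈ s, cechMap y (f i) q z := by
  ext1 S
  simp only [cechMap_apply, awayModuleMap, map_sum, LinearMap.sum_apply, Finset.sum_apply]

theorem cechMap_id (q : ℕ) (z : CechCochain y M q) : cechMap y LinearMap.id q z = z := by
  ext1 S
  rw [cechMap_apply, awayModuleMap, IsLocalizedModule.map_id]
  rfl

theorem cechMap_smul (a : A) (f : M →ₗ[A] N) (q : ℕ) (z : CechCochain y M q) :
    cechMap y (a • f) q z = a • cechMap y f q z := by
  ext1 S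
  rw [cechMap_apply, awayModuleMap, map_smul]
  rfl

/-- The identity of a finite power is the sum of its coordinate inclusions after projections, and
the Čech complex is additive in the map. -/
theorem mem_almostClosure_cechCoboundaries_pi {ι : Type} [Fintype ι] [DecidableEq ι] {q : ℕ}
    (z : CechCochain y (ι → M) q)
    (h : ∀ i, cechMap y (LinearMap.proj i : (ι → M) →ₗ[A] M) q z ∈ almostClosure hv (cechCoboundaries y M q)) :
    z ∈ almostClosure hv (cechCoboundaries y (ι → M) q) := by
  have hid : (LinearMap.id : (ι → M) →ₗ[A] (ι → M)) =
      ∑ i, LinearMap.single A (fun _ => M) i ∘ₗ LinearMap.proj i := by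
    refine LinearMap.ext fun m => ?_
    rw [LinearMap.sum_apply]
    exact (LinearMap.sum_single_apply (φ := fun _ : ι => M) m).symm
  rw [← cechMap_id y q z, hid, cechMap_sum]
  refine sum_mem fun i _ => ?_
  rw [cechMap_comp]
  exact map_mem_almostClosure hv _ (cechMap_mem_cechCoboundaries y _ q) (h i)

theorem CechAlmostZero.pi {ι : Type} [Fintype ι] [DecidableEq ι] {q : ℕ}
    (hM : CechAlmostZero hv y M q) : CechAlmostZero hv y (ι → M) q := fun z hz =>
  mem_almostClosure_cechCoboundaries_pi hv y z fun i =>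
    hM (cechMap_mem_ker y (LinearMap.proj i : (ι → M) →ₗ[A] M) hz)

end CechAlmostZero

/-! ## Čech cohomology is torsion -/

section CechTorsion

variable {A : Type u} [CommRing A] {n : ℕ} (y : Fin n → A) {M : Type w} [AddCommGroup M]
  [Module A M]

/-- For `c = b * a`, `M_c` is the localization of `M_a` at `b`: multiplying `m / c^k` by `b^k` gives
the image of `m / a^k`. -/
theorem exists_pow_smul_eq_awayMap {a b c : A} (h : a ∣ c) (hc : c = b * a) (u : AwayModule M c) :
    ∃ (N : ℕ) (w : AwayModule M a), awayMap M h w = b ^ N • u := by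
  induction u using LocalizedModule.induction_on with
  | h m s =>
    obtain ⟨_, k, rfl⟩ := s
    refine ⟨k, LocalizedModule.mk m ⟨a ^ k, k, rfl⟩, ?_⟩
    have hu := isUnit_algebraMap_end_awayModule M h ⟨a ^ k, k, rfl⟩
    apply ((Module.End.isUnit_iff _).mp hu).1
    simp only [Module.algebraMap_end_apply]
    rw [← map_smul, LocalizedModule.smul'_mk, smul_smul, LocalizedModule.smul'_mk, ← mul_pow,
      mul_comm a b, ← hc]
    have e1 := LocalizedModule.mk_cancel (⟨a ^ k, k, rfl⟩ : Submonoid.powers a) m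
    have e2 := LocalizedModule.mk_cancel (⟨c ^ k, k, rfl⟩ : Submonoid.powers c) m
    simp only [Submonoid.smul_def] at e1 e2
    rw [e1, e2]
    exact awayMap_mkLinearMap h m

theorem LocalizedModule.mk_eq_zero {S : Submonoid A} (m : M) (s : S) :
    LocalizedModule.mk m s = 0 ↔ ∃ u : S, u • m = 0 := by
  rw [← LocalizedModule.zero_mk 1, LocalizedModule.mk_eq]
  simp

theorem exists_pow_smul_eq_zero_of_awayMap {a b c : A} (h : a ∣ c) (hc : c = b * a)
    (w : AwayModule M a) (hw : awayMap M h w = 0) : ∃ N : ℕ, b ^ N • w = 0 := by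
  induction w using LocalizedModule.induction_on with
  | h m s =>
    obtain ⟨_, k, rfl⟩ := s
    have h0 : awayMap M h (LocalizedModule.mk m 1) = 0 := by
      have e1 := LocalizedModule.mk_cancel (⟨a ^ k, k, rfl⟩ : Submonoid.powers a) m
      simp only [Submonoid.smul_def] at e1
      rw [← e1, ← LocalizedModule.smul'_mk, map_smul, hw, smul_zero]
    have h1 : LocalizedModule.mkLinearMap (Submonoid.powers c) M m = 0 := by
      rw [← awayMap_mkLinearMap h]; exact h0
    rw [LocalizedModule.mkLinearMap_apply, LocalizedModule.mk_eq_zero] at h1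
    obtain ⟨⟨_, N, rfl⟩, hN⟩ := h1
    refine ⟨N, ?_⟩
    rw [LocalizedModule.smul'_mk, LocalizedModule.mk_eq_zero]
    refine ⟨⟨a ^ N, N, rfl⟩, ?_⟩
    rw [Submonoid.smul_def, smul_smul, ← mul_pow, mul_comm a b, ← hc]
    exact hN

end CechTorsion

section CechTorsion

variable {A : Type u} [CommRing A] {n : ℕ} (y : Fin n → A) {M : Type w} [AddCommGroup M]
  [Module A M]

theorem alternatingSign_mul_self (S : Finset (Fin n)) (s : Fin n) :
    alternatingSign A S s * alternatingSign A S s = 1 := by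
  rw [alternatingSign, ← mul_pow]; simp

theorem alternatingSign_erase_self (S : Finset (Fin n)) (s : Fin n) :
    alternatingSign A (S.erase s) s = alternatingSign A S s := by
  unfold alternatingSign
  congr 2; ext q; simp; grind

theorem alternatingSign_insert_self (S : Finset (Fin n)) (s : Fin n) :
    alternatingSign A (insert s S) s = alternatingSign A S s := by
  rw [← alternatingSign_erase_self (insert s S), Finset.erase_insert_eq_erase,
    alternatingSign_erase_self]

theorem alternatingSign_erase_mul {T : Finset (Fin n)} {s t : Fin n} (hs : s ∉ T) (ht : t ∈ T) :
    alternatingSign A T t * alternatingSign A (T.erase t) s =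
      -(alternatingSign A T s * alternatingSign A (insert s T) t) := by
  have hst : s ≠ t := fun h => hs (h ▸ ht)
  have key := alternatingSign_mul_insert (A := A) (T.erase t) (s := s) (t := t)
    (fun h => hs (Finset.mem_of_mem_erase h)) (by simp) hst
  rw [Finset.insert_erase ht, ← Finset.erase_insert_of_ne hst, alternatingSign_erase_self,
    alternatingSign_erase_self] at key
  have h1 := alternatingSign_mul_self (A := A) T t
  have h2 := alternatingSign_mul_self (A := A) (insert s T) t
  linear_combination (alternatingSign A T t * alternatingSign A (insert s T) t) * key -
    alternatingSign A T t * alternatingSign A (T.erase t) s * h2 -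
    alternatingSign A T s * alternatingSign A (insert s T) t * h1

/-- The restriction map between the localizations indexed by `S ⊆ T`. -/
noncomputable def cechRes (M : Type w) [AddCommGroup M] [Module A M] {S T : Finset (Fin n)}
    (h : S ⊆ T) : AwayModule M (∏ s ∈ S, y s) →ₗ[A] AwayModule M (∏ s ∈ T, y s) :=
  awayMap M (Finset.prod_dvd_prod_of_subset _ _ y h)

theorem cechRes_cechRes {S T U : Finset (Fin n)} (h : S ⊆ T) (h' : T ⊆ U)
    (m : AwayModule M (∏ s ∈ S, y s)) :
    cechRes y M h' (cechRes y M h m) = cechRes y M (h.trans h') m :=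
  awayMap_awayMap M _ _ m

theorem cechRes_congr (Z : ∀ S : Finset (Fin n), AwayModule M (∏ s ∈ S, y s))
    {S S' T : Finset (Fin n)} (e : S = S') (h : S ⊆ T) (h' : S' ⊆ T) :
    cechRes y M h (Z S) = cechRes y M h' (Z S') := by
  subst e; rfl

variable {y} in
/-- The extension by zero of a Čech cochain to all index sets. -/
noncomputable def cechExt {q : ℕ} (z : CechCochain y M q) (S : Finset (Fin n)) :
    AwayModule M (∏ s ∈ S, y s) :=
  if h : S.card = q then z ⟨S, h⟩ else 0

theorem cechD_apply {q : ℕ} (z : CechCochain y M q) (S : {S : Finset (Fin n) // S.card = q + 1}) :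
    cechD y M q z S = ∑ t ∈ S.1, alternatingSign A S.1 t •
      cechRes y M (Finset.erase_subset t S.1) (cechExt z (S.1.erase t)) := by
  rw [← Finset.sum_coe_sort S.1 (fun t => alternatingSign A S.1 t •
      cechRes y M (Finset.erase_subset t S.1) (cechExt z (S.1.erase t)))]
  simp only [cechD, LinearMap.pi_apply, LinearMap.sum_apply, LinearMap.smul_apply,
    LinearMap.proj_apply, LinearMap.comp_apply]
  refine Finset.sum_congr rfl fun s _ => ?_
  have hc : (S.1.erase s.1).card = q := by
    rw [Finset.card_erase_of_mem s.2, S.2, Nat.add_sub_cancel]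
  rw [cechExt, dif_pos hc]
  rfl

/-- The cocycle condition at `insert s T`, solved for the term that omits `s`. -/
theorem cechRes_eq_neg_sum {q : ℕ} {z : CechCochain y M q}
    (hz : z ∈ LinearMap.ker (cechD y M q)) {s : Fin n} {T : Finset (Fin n)} (hT : T.card = q)
    (hs : s ∉ T) :
    cechRes y M (Finset.subset_insert s T) (cechExt z T) =
      -∑ t ∈ T, (alternatingSign A T s * alternatingSign A (insert s T) t) •
        cechRes y M (Finset.erase_subset t _) (cechExt z ((insert s T).erase t)) := by
  have h0 := congrFun (LinearMap.mem_ker.mp hz)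
    ⟨insert s T, by rw [Finset.card_insert_of_notMem hs, hT]⟩
  rw [cechD_apply, Finset.sum_insert hs, alternatingSign_insert_self,
    cechRes_congr y (cechExt z) (Finset.erase_insert hs) _ (Finset.subset_insert s T)] at h0
  have h1 := congrArg (fun m => alternatingSign A T s • m) h0
  simp only [smul_add, smul_smul, alternatingSign_mul_self, one_smul, Finset.smul_sum,
    Pi.zero_apply, smul_zero] at h1
  exact eq_neg_of_add_eq_zero_left h1

theorem exists_pow_smul_eq_zero_of_cechRes {q : ℕ} (s : Fin n) (z : CechCochain y M q)
    (h : ∀ T : {S : Finset (Fin n) // S.card = q}, s ∈ T.1 → z T = 0)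
    (h' : ∀ T : {S : Finset (Fin n) // S.card = q}, s ∉ T.1 →
      cechRes y M (Finset.subset_insert s T.1) (z T) = 0) : ∃ N : ℕ, y s ^ N • z = 0 := by
  have key : ∀ T, ∃ N : ℕ, y s ^ N • z T = 0 := fun T => by
    by_cases hT : s ∈ T.1
    · exact ⟨0, by rw [h T hT, smul_zero]⟩
    · exact exists_pow_smul_eq_zero_of_awayMap _ (Finset.prod_insert hT) (z T) (h' T hT)
  choose N hN using key
  refine ⟨Finset.univ.sup N, funext fun T => ?_⟩
  obtain ⟨k, hk⟩ := Nat.exists_eq_add_of_le (Finset.le_sup (f := N) (Finset.mem_univ T))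
  rw [Pi.smul_apply, hk, add_comm, pow_add, mul_smul, hN, smul_zero, Pi.zero_apply]

/-- Every Čech cohomology class is killed by a power of each `y s`. -/
theorem exists_pow_smul_mem_cechCoboundaries {q : ℕ} {z : CechCochain y M q}
    (hz : z ∈ LinearMap.ker (cechD y M q)) (s : Fin n) :
    ∃ N : ℕ, y s ^ N • z ∈ cechCoboundaries y M q := by
  cases q with
  | zero =>
    refine exists_pow_smul_eq_zero_of_cechRes y s z (fun T hT => ?_) (fun T hT => ?_)
    · rw [Finset.card_eq_zero.mp T.2] at hT; simp at hT
    · have := cechRes_eq_neg_sum y hz T.2 hT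
      rw [Finset.sum_eq_zero (fun t ht => by
        rw [Finset.card_eq_zero.mp T.2] at ht; simp at ht), neg_zero] at this
      rwa [cechExt, dif_pos T.2] at this
  | succ q =>
    -- After inverting `y s` the Čech complex is contractible, the homotopy sending `z` to its
    -- components at `insert s S`. Here that homotopy is realized with its denominators cleared.
    have key : ∀ S : Finset (Fin n), s ∉ S → ∃ (N : ℕ) (w : AwayModule M (∏ t ∈ S, y t)),
        cechRes y M (Finset.subset_insert s S) w =
          y s ^ N • (alternatingSign A S s • cechExt z (insert s S)) := fun S hS =>
      exists_pow_smul_eq_awayMap _ (Finset.prod_insert hS) _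
    choose! N w hw using key
    -- A common exponent for all index sets; the deficit `K - N S` is compensated in `W`.
    let K := Finset.univ.sup N
    let W : ∀ S : Finset (Fin n), AwayModule M (∏ t ∈ S, y t) := fun S =>
      if s ∈ S then 0 else y s ^ (K - N S) • w S
    have hW : ∀ S, s ∉ S → ∀ T (h : S ⊆ T), insert s S = T →
        cechRes y M h (W S) = y s ^ K • (alternatingSign A S s • cechExt z T) := by
      rintro S hS _ h rfl
      simp only [W, if_neg hS]
      rw [map_smul, hw S hS, smul_smul, ← pow_add,
        Nat.sub_add_cancel (Finset.le_sup (f := N) (Finset.mem_univ S))]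
    have hW' : ∀ S, s ∈ S → W S = 0 := fun S hS => if_pos hS
    let W' : CechCochain y M q := fun S => W S.1
    have hext : ∀ S, S.card = q → cechExt W' S = W S := fun S hS => dif_pos hS
    have hcard : ∀ (T : Finset (Fin n)) t, T.card = q + 1 → t ∈ T → (T.erase t).card = q := by
      intro T t hT ht
      rw [Finset.card_erase_of_mem ht, hT, Nat.add_sub_cancel]
    -- The error of the homotopy is zero at index sets containing `s`. At the others it vanishes
    -- after inverting `y s`, by the cocycle condition, so a further power of `y s` kills it.
    obtain ⟨N', hN'⟩ := exists_pow_smul_eq_zero_of_cechRes y s (y s ^ K • z - cechD y M q W')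
      (fun T hT => by
        have hsum : cechD y M q W' T = y s ^ K • z T := by
          rw [cechD_apply, Finset.sum_eq_single s]
          · rw [hext _ (hcard _ _ T.2 hT), hW _ (Finset.notMem_erase s T.1) _ _
              (Finset.insert_erase hT), alternatingSign_erase_self, smul_comm, smul_smul,
              smul_smul, mul_assoc, alternatingSign_mul_self, mul_one, cechExt, dif_pos T.2]
          · intro t ht hts
            rw [hext _ (hcard _ _ T.2 ht), hW' _ (Finset.mem_erase.mpr ⟨hts.symm, hT⟩), map_zero,
              smul_zero]
          · exact fun h => absurd hT h
        rw [Pi.sub_apply, hsum, Pi.smul_apply, sub_self])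
      (fun T hT => by
        have hzT : cechExt z T.1 = z T := dif_pos T.2
        rw [Pi.sub_apply, map_sub, Pi.smul_apply, map_smul, ← hzT, cechRes_eq_neg_sum y hz T.2 hT,
          cechD_apply, map_sum, sub_eq_zero, smul_neg, Finset.smul_sum, ← Finset.sum_neg_distrib]
        refine Finset.sum_congr rfl fun t ht => ?_
        have hst : s ≠ t := fun h => hT (h ▸ ht)
        rw [hext _ (hcard _ _ T.2 ht), map_smul, cechRes_cechRes, ← cechRes_cechRes y
          (Finset.erase_subset_erase t (Finset.subset_insert s T.1)) (Finset.erase_subset t _),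
          hW _ (fun h => hT (Finset.mem_of_mem_erase h)) _ _
            (Finset.erase_insert_of_ne hst).symm, map_smul, map_smul, smul_smul, smul_smul,
          smul_smul, ← neg_smul]
        congr 1
        linear_combination (-y s ^ K) * alternatingSign_erase_mul (A := A) hT ht)
    refine ⟨N' + K, y s ^ N' • W', ?_⟩
    rw [smul_sub, sub_eq_zero] at hN'
    rw [map_smul, ← hN', smul_smul, pow_add]

end CechTorsion

/-! ## The total Koszul complex -/

section TotalKoszul

variable {A : Type u} [CommRing A] {n : ℕ} (x : Fin n → A)

/-- The Koszul differential on the direct sum of all `K_i(x; A)`. -/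
def totalKoszulD : (Finset (Fin n) → A) →ₗ[A] (Finset (Fin n) → A) :=
  LinearMap.pi fun S => ∑ s, if s ∈ S then 0 else
    (alternatingSign A S s * x s) • LinearMap.proj (insert s S)

/-- Left multiplication by the basis element `e_s` of the exterior algebra. -/
def koszulWedge (s : Fin n) : (Finset (Fin n) → A) →ₗ[A] (Finset (Fin n) → A) :=
  LinearMap.pi fun S => if s ∈ S then alternatingSign A S s • LinearMap.proj (S.erase s) else 0

/-- Contraction with the dual of the basis element `e_s` of the exterior algebra. -/
def koszulContract (s : Fin n) : (Finset (Fin n) → A) →ₗ[A] (Finset (Fin n) → A) :=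
  LinearMap.pi fun S => if s ∈ S then 0 else alternatingSign A S s • LinearMap.proj (insert s S)

theorem totalKoszulD_apply (F : Finset (Fin n) → A) (S : Finset (Fin n)) :
    totalKoszulD x F S =
      ∑ s, if s ∈ S then 0 else alternatingSign A S s * x s * F (insert s S) := by
  simp only [totalKoszulD, LinearMap.pi_apply, LinearMap.sum_apply]
  refine Finset.sum_congr rfl fun s _ => ?_
  split_ifs <;> rfl

theorem koszulWedge_apply (s : Fin n) (F : Finset (Fin n) → A) (S : Finset (Fin n)) :
    koszulWedge s F S = if s ∈ S then alternatingSign A S s * F (S.erase s) else 0 := by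
  simp only [koszulWedge, LinearMap.pi_apply]
  split_ifs <;> rfl

theorem koszulContract_apply (s : Fin n) (F : Finset (Fin n) → A) (S : Finset (Fin n)) :
    koszulContract s F S = if s ∈ S then 0 else alternatingSign A S s * F (insert s S) := by
  simp only [koszulContract, LinearMap.pi_apply]
  split_ifs <;> rfl

/-- The Leibniz rule for `e_s ∧ F`: wedging with `e_s` is a homotopy from multiplication by `x s` to
zero. -/
theorem totalKoszulD_koszulWedge (s : Fin n) (F : Finset (Fin n) → A) :
    totalKoszulD x (koszulWedge s F) = x s • F - koszulWedge s (totalKoszulD x F) := by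
  rw [eq_sub_iff_add_eq]
  ext S
  rw [Pi.add_apply, Pi.smul_apply, totalKoszulD_apply, koszulWedge_apply]
  by_cases hs : s ∈ S
  · rw [if_pos hs, totalKoszulD_apply, Finset.mul_sum, ← Finset.sum_add_distrib,
      Finset.sum_eq_single s]
    · rw [if_pos hs, if_neg (Finset.notMem_erase s S), Finset.insert_erase hs,
        alternatingSign_erase_self, smul_eq_mul]
      linear_combination (x s * F S) * alternatingSign_mul_self (A := A) S s
    · intro t _ hts
      by_cases ht : t ∈ S
      · rw [if_pos ht, if_pos (Finset.mem_erase.mpr ⟨hts, ht⟩)]; simp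
      · rw [if_neg ht, if_neg (fun h => ht (Finset.mem_of_mem_erase h)), koszulWedge_apply,
          if_pos (Finset.mem_insert_of_mem hs), Finset.erase_insert_of_ne hts]
        linear_combination (x t * F (insert t (S.erase s))) *
          alternatingSign_erase_mul (A := A) ht hs
    · simp
  · rw [if_neg hs, add_zero, Finset.sum_eq_single s]
    · rw [if_neg hs, koszulWedge_apply, if_pos (Finset.mem_insert_self s S),
        alternatingSign_insert_self, Finset.erase_insert hs, smul_eq_mul]
      linear_combination (x s * F S) * alternatingSign_mul_self (A := A) S s
    · intro t _ hts
      have h : s ∉ insert t S := by simp [hs, hts.symm]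
      rw [koszulWedge_apply, if_neg h, mul_zero, ite_self]
    · simp

theorem totalKoszulD_koszulContract (s : Fin n) (F : Finset (Fin n) → A) :
    totalKoszulD x (koszulContract s F) = -koszulContract s (totalKoszulD x F) := by
  rw [eq_neg_iff_add_eq_zero]
  ext S
  rw [Pi.add_apply, totalKoszulD_apply, koszulContract_apply, Pi.zero_apply]
  by_cases hs : s ∈ S
  · rw [if_pos hs, add_zero]
    refine Finset.sum_eq_zero fun t _ => ?_
    rw [koszulContract_apply, if_pos (Finset.mem_insert_of_mem hs), mul_zero, ite_self]
  · rw [if_neg hs, totalKoszulD_apply, Finset.mul_sum, ← Finset.sum_add_distrib]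
    refine Finset.sum_eq_zero fun t _ => ?_
    by_cases hts : t = s
    · subst hts
      simp [hs, koszulContract_apply]
    by_cases ht : t ∈ S
    · simp [ht]
    · rw [if_neg ht, koszulContract_apply, if_neg (by simp [hs, Ne.symm hts]),
        if_neg (by simp [hts, ht]), Finset.insert_comm]
      linear_combination (x t * F (insert t (insert s S))) *
        alternatingSign_mul_insert (A := A) S ht hs hts

/-- The chains of degree `i` on the first `k` elements of the sequence. -/
def initialChains (A : Type u) [CommRing A] (n i k : ℕ) : Submodule A (Finset (Fin n) → A) where
  carrier := {F | ∀ S, ¬ (S.card = i ∧ ∀ j ∈ S, j.1 < k) → F S = 0}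
  zero_mem' := fun _ _ => rfl
  add_mem' := fun hF hG S hS => by rw [Pi.add_apply, hF S hS, hG S hS, add_zero]
  smul_mem' := fun a F hF S hS => by rw [Pi.smul_apply, hF S hS, smul_zero]

theorem initialChains_fg (i k : ℕ) : (initialChains A n i k).FG := by
  classical
  let p : (Finset (Fin n) → A) →ₗ[A] (Finset (Fin n) → A) := LinearMap.pi fun S =>
    if S.card = i ∧ ∀ j ∈ S, j.1 < k then LinearMap.proj S else 0
  have hp : ∀ F S, p F S = if S.card = i ∧ ∀ j ∈ S, j.1 < k then F S else 0 := fun F S => by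
    simp only [p, LinearMap.pi_apply]
    split_ifs <;> rfl
  have : initialChains A n i k = LinearMap.range p := by
    ext F
    constructor
    · intro hF
      refine ⟨F, funext fun S => ?_⟩
      rw [hp]
      split_ifs with h
      · rfl
      · exact (hF S h).symm
    · rintro ⟨G, rfl⟩ S hS
      rw [hp, if_neg hS]
  rw [this]
  exact Module.Finite.iff_fg.mp inferInstance

theorem initialChains_mono {i k l : ℕ} (h : k ≤ l) :
    initialChains A n i k ≤ initialChains A n i l :=
  fun _ hF S hS => hF S fun hS' => hS ⟨hS'.1, fun j hj => (hS'.2 j hj).trans_le h⟩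

theorem totalKoszulD_mem_initialChains {i k : ℕ} {F : Finset (Fin n) → A}
    (hF : F ∈ initialChains A n (i + 1) k) : totalKoszulD x F ∈ initialChains A n i k := by
  intro S hS
  rw [totalKoszulD_apply]
  refine Finset.sum_eq_zero fun s _ => ?_
  split_ifs with hs
  · rfl
  · rw [hF _ fun h => hS ⟨?_, fun j hj => h.2 j (Finset.mem_insert_of_mem hj)⟩, mul_zero]
    have := h.1
    rw [Finset.card_insert_of_notMem hs] at this
    omega

theorem totalKoszulD_eq_zero {k : ℕ} {F : Finset (Fin n) → A}
    (hF : F ∈ initialChains A n 0 k) : totalKoszulD x F = 0 := by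
  ext S
  rw [totalKoszulD_apply]
  refine Finset.sum_eq_zero fun s _ => ?_
  split_ifs with hs
  · rfl
  · rw [hF _ fun h => by simp at h, mul_zero]

theorem koszulWedge_mem_initialChains {i k l : ℕ} {F : Finset (Fin n) → A} (s : Fin n)
    (hs : s.1 < l) (hkl : k ≤ l) (hF : F ∈ initialChains A n i k) :
    koszulWedge s F ∈ initialChains A n (i + 1) l := by
  intro S hS
  rw [koszulWedge_apply]
  split_ifs with h
  · rw [hF _ fun hS' => hS ⟨?_, fun j hj => ?_⟩, mul_zero]
    · rw [← Finset.card_erase_add_one h, hS'.1]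
    · by_cases hjs : j = s
      · rwa [hjs]
      · exact (hS'.2 j (Finset.mem_erase.mpr ⟨hjs, hj⟩)).trans_le hkl
  · rfl

theorem koszulContract_mem_initialChains {i : ℕ} (k : Fin n) {F : Finset (Fin n) → A}
    (hF : F ∈ initialChains A n (i + 1) (k.1 + 1)) :
    koszulContract k F ∈ initialChains A n i k := by
  intro S hS
  rw [koszulContract_apply]
  split_ifs with h
  · rfl
  · rw [hF _ fun hS' => hS ⟨?_, fun j hj => ?_⟩, mul_zero]
    · have := hS'.1
      rw [Finset.card_insert_of_notMem h] at this
      omega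
    · have h1 := hS'.2 j (Finset.mem_insert_of_mem hj)
      have h2 : j.1 ≠ k.1 := fun e => h (Fin.ext e ▸ hj)
      omega

theorem koszulContract_eq_zero {i : ℕ} (k : Fin n) {F : Finset (Fin n) → A}
    (hF : F ∈ initialChains A n i k) : koszulContract k F = 0 := by
  ext S
  rw [koszulContract_apply]
  split_ifs with h
  · rfl
  · rw [hF _ fun hS => (hS.2 k (Finset.mem_insert_self _ _)).false, mul_zero, Pi.zero_apply]

theorem koszulContract_koszulWedge {i : ℕ} (k : Fin n) {F : Finset (Fin n) → A}
    (hF : F ∈ initialChains A n i k) : koszulContract k (koszulWedge k F) = F := by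
  ext S
  rw [koszulContract_apply]
  split_ifs with h
  · exact (hF S fun hS => (hS.2 k h).false).symm
  · rw [koszulWedge_apply, if_pos (Finset.mem_insert_self _ _), alternatingSign_insert_self,
      Finset.erase_insert h, ← mul_assoc, alternatingSign_mul_self, one_mul]

theorem sub_koszulWedge_koszulContract_mem {i : ℕ} (k : Fin n) {F : Finset (Fin n) → A}
    (hF : F ∈ initialChains A n i (k.1 + 1)) :
    F - koszulWedge k (koszulContract k F) ∈ initialChains A n i k := by
  intro S hS
  rw [Pi.sub_apply, koszulWedge_apply]
  split_ifs with h
  · rw [koszulContract_apply, if_neg (Finset.notMem_erase _ _), Finset.insert_erase h,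
      alternatingSign_erase_self, ← mul_assoc, alternatingSign_mul_self, one_mul, sub_self]
  · rw [sub_zero]
    refine hF S fun hS' => hS ⟨hS'.1, fun j hj => ?_⟩
    have h1 := hS'.2 j hj
    have h2 : j.1 ≠ k.1 := fun e => h (Fin.ext e ▸ hj)
    omega

/-- The cycles of degree `i` of the Koszul complex on the first `k` elements. -/
def initialCycles (i k : ℕ) : Submodule A (Finset (Fin n) → A) :=
  initialChains A n i k ⊓ LinearMap.ker (totalKoszulD x)

/-- The boundaries of degree `i` of the Koszul complex on the first `k` elements. -/
def initialBoundaries (i k : ℕ) : Submodule A (Finset (Fin n) → A) :=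
  (initialChains A n (i + 1) k).map (totalKoszulD x)

theorem initialBoundaries_mono {i k l : ℕ} (h : k ≤ l) :
    initialBoundaries x i k ≤ initialBoundaries x i l :=
  Submodule.map_mono (initialChains_mono h)

theorem totalKoszulD_empty (F : Finset (Fin n) → A) :
    totalKoszulD x F ∅ = ∑ s, x s * F {s} := by
  simp [totalKoszulD_apply, alternatingSign]

theorem mem_initialIdeal_iff (k : Fin n) {a : A} :
    a ∈ initialIdeal x k ↔ ∃ G ∈ initialChains A n 1 k, totalKoszulD x G ∅ = a := by
  constructor
  · intro ha
    have : initialIdeal x k ≤ (initialChains A n 1 k).map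
        (LinearMap.proj ∅ ∘ₗ totalKoszulD x) := by
      rw [initialIdeal, Ideal.span, Submodule.span_le]
      rintro _ ⟨j, hj, rfl⟩
      refine ⟨Pi.single {j} 1, fun S hS => Pi.single_eq_of_ne ?_ 1, ?_⟩
      · rintro rfl
        exact hS (by simpa using hj)
      · rw [LinearMap.comp_apply, LinearMap.proj_apply, totalKoszulD_empty,
          Finset.sum_eq_single j]
        · simp
        · intro s _ hs
          rw [Pi.single_eq_of_ne (by simpa using hs), mul_zero]
        · simp
    exact this ha
  · rintro ⟨G, hG, rfl⟩
    rw [totalKoszulD_empty]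
    refine sum_mem fun s _ => ?_
    by_cases hs : s < k
    · exact Ideal.mul_mem_right _ _ (Ideal.subset_span ⟨s, hs, rfl⟩)
    · rw [hG {s} fun h => hs (h.2 s (by simp)), mul_zero]
      exact zero_mem _

theorem initialChains_zero_ext {k : ℕ} {F G : Finset (Fin n) → A}
    (hF : F ∈ initialChains A n 0 k) (hG : G ∈ initialChains A n 0 k) (h : F ∅ = G ∅) :
    F = G := by
  ext S
  by_cases hS : S = ∅
  · rw [hS, h]
  · rw [hF S fun h => hS (Finset.card_eq_zero.mp h.1), hG S fun h => hS (Finset.card_eq_zero.mp h.1)]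

theorem mem_initialBoundaries_zero_iff (k : Fin n) {F : Finset (Fin n) → A}
    (hF : F ∈ initialChains A n 0 k) : F ∈ initialBoundaries x 0 k ↔ F ∅ ∈ initialIdeal x k := by
  rw [mem_initialIdeal_iff]
  constructor
  · rintro ⟨G, hG, rfl⟩
    exact ⟨G, hG, rfl⟩
  · rintro ⟨G, hG, h⟩
    exact ⟨G, hG, initialChains_zero_ext (totalKoszulD_mem_initialChains x hG) hF h⟩

theorem totalKoszulD_koszulContract_eq_zero (k : Fin n) {F : Finset (Fin n) → A}
    (h : koszulContract k (totalKoszulD x F) = 0) :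
    totalKoszulD x (koszulContract k F) = 0 := by
  rw [totalKoszulD_koszulContract, h, neg_zero]

/-- If all colon quotients of a sequence are almost zero, then so is its higher Koszul homology. -/
theorem initialCycles_le_almostClosure {v : ValueMap A} (hv : v 1 = 0)
    (h : ∀ (k : Fin n) (a : A), x k * a ∈ initialIdeal x k →
      a ∈ almostClosure hv (initialIdeal x k)) (k : ℕ) (hk : k ≤ n) (i : ℕ) :
    initialCycles x (i + 1) k ≤ almostClosure hv (initialBoundaries x (i + 1) k) := by
  induction k generalizing i with
  | zero =>
    rintro F ⟨hF, -⟩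
    have : F = 0 := funext fun S => hF S fun hS => by
      obtain ⟨j, hj⟩ := Finset.card_pos.mp (by rw [hS.1]; exact Nat.succ_pos i)
      exact absurd (hS.2 j hj) (Nat.not_lt_zero _)
    rw [this]
    exact zero_mem _
  | succ k ih =>
    rintro F ⟨hF, hDF⟩
    have hDF : totalKoszulD x F = 0 := hDF
    obtain ⟨k, rfl⟩ : ∃ k' : Fin n, k'.1 = k := ⟨⟨k, hk⟩, rfl⟩
    -- Decompose `F = F₀ + e_k ∧ F₁` with `F₀` and `F₁` on the first `k` elements. Then `F₁` is a
    -- cycle and `d F₀ = -x_k F₁`.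
    have hF1 := koszulContract_mem_initialChains k hF
    have hF0 := sub_koszulWedge_koszulContract_mem k hF
    have hDF1 : totalKoszulD x (koszulContract k F) = 0 :=
      totalKoszulD_koszulContract_eq_zero x k (by rw [hDF, map_zero])
    have hDF0 : totalKoszulD x (F - koszulWedge k (koszulContract k F)) =
        -(x k • koszulContract k F) := by
      rw [map_sub, hDF, totalKoszulD_koszulWedge, hDF1, map_zero, sub_zero, zero_sub]
    have key : koszulContract k F ∈ almostClosure hv (initialBoundaries x i k) := by
      cases i with
      | succ i => exact ih k.2.le i ⟨hF1, hDF1⟩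
      | zero =>
        -- In degree zero `F₁` is a scalar, and `x_k F₁ = -d F₀` places it in the colon ideal.
        have h1 : koszulContract k F ∅ ∈ almostClosure hv (initialIdeal x k) := by
          refine h k _ ?_
          rw [mem_initialIdeal_iff]
          exact ⟨_, neg_mem hF0, by rw [map_neg, hDF0, neg_neg]; rfl⟩
        intro ε hε
        obtain ⟨b, hb, hb'⟩ := h1 ε hε
        exact ⟨b, hb, (mem_initialBoundaries_zero_iff x k
          (Submodule.smul_mem _ b hF1)).mpr hb'⟩
    refine mem_almostClosure_of_smul_mem hv fun ε hε => ?_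
    obtain ⟨b, hb, g, hg, hgb⟩ := key ε hε
    refine ⟨b, hb, ?_⟩
    -- With `b F₁ = d g`, adding the boundary of `e_k ∧ g` to `b F` removes `e_k` and leaves a cycle
    -- on the first `k` elements.
    have e : b • F + totalKoszulD x (koszulWedge k g) =
        b • (F - koszulWedge k (koszulContract k F)) + x k • g := by
      rw [totalKoszulD_koszulWedge, hgb, map_smul, smul_sub]
      abel
    have hmem : b • F + totalKoszulD x (koszulWedge k g) ∈ initialCycles x (i + 1) k := by
      refine ⟨?_, ?_⟩
      · rw [e]
        exact add_mem (Submodule.smul_mem _ _ hF0) (Submodule.smul_mem _ _ hg)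
      · rw [e]
        change totalKoszulD x _ = 0
        rw [map_add, map_smul, map_smul, hDF0, hgb, smul_neg, smul_comm]
        exact neg_add_cancel _
    have h1 := almostClosure_mono hv (initialBoundaries_mono x (Nat.le_succ k))
      (ih k.2.le i hmem)
    have h2 : totalKoszulD x (koszulWedge k g) ∈
        almostClosure hv (initialBoundaries x (i + 1) (k + 1)) :=
      le_almostClosure hv _ ⟨_, koszulWedge_mem_initialChains k (Nat.lt_succ_self _)
        (Nat.le_succ _) hg, rfl⟩
    simpa using sub_mem h1 h2

/-- The vanishing of `H₁(x₁, …, x_k)` descends to initial segments if the `x_i` are in the Jacobson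
radical and cycles are finitely generated. -/
theorem initialCycles_one_le_of_le (hfg : ∀ k, (initialCycles x 1 k).FG)
    (hx : ∀ j, x j ∈ Ideal.jacobson (⊥ : Ideal A))
    (h : initialCycles x 1 n ≤ initialBoundaries x 1 n) {k : ℕ} (hk : k ≤ n) :
    initialCycles x 1 k ≤ initialBoundaries x 1 k := by
  induction hk using Nat.decreasingInduction with
  | self => exact h
  | of_succ k hk ih =>
    refine Submodule.le_of_le_smul_of_le_jacobson_bot (I := Ideal.span {x ⟨k, hk⟩}) (hfg k)
      ((Ideal.span_singleton_le_iff_mem _).mpr (hx _)) ?_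
    obtain ⟨k, rfl⟩ : ∃ k' : Fin n, k'.1 = k := ⟨⟨k, hk⟩, rfl⟩
    rintro f ⟨hf, hDf⟩
    -- Writing `g = g₀ + e_k ∧ g₁`, the cycle is `d g₀ + x_k g₁` with `g₁` again a cycle on the
    -- first `k` elements. So `x_k` times the cycles, together with the boundaries, exhausts the
    -- cycles, and Nakayama applies.
    obtain ⟨g, hg, rfl⟩ := ih ⟨initialChains_mono (Nat.le_succ _) hf, hDf⟩
    have hg1 := koszulContract_mem_initialChains k hg
    have hDg1 : totalKoszulD x (koszulContract k g) = 0 :=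
      totalKoszulD_koszulContract_eq_zero x k (koszulContract_eq_zero k hf)
    have e : totalKoszulD x g = totalKoszulD x (g - koszulWedge k (koszulContract k g)) +
        x k • koszulContract k g := by
      rw [map_sub, totalKoszulD_koszulWedge, hDg1, map_zero, sub_zero, sub_add_cancel]
    rw [e]
    exact Submodule.add_mem_sup ⟨_, sub_koszulWedge_koszulContract_mem k hg, rfl⟩
      (Submodule.smul_mem_smul (Ideal.mem_span_singleton_self _) ⟨hg1, hDg1⟩)

/-- If `x_k a = d G` with `G` on the earlier elements, then `a e_k - G` is a cycle, hence a boundary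
`d g`. Contracting with `e_k` exhibits `a` as a boundary on the earlier elements. -/
theorem mem_initialIdeal_of_mul_mem (k : Fin n)
    (h : initialCycles x 1 (k.1 + 1) ≤ initialBoundaries x 1 (k.1 + 1)) {a : A}
    (ha : x k * a ∈ initialIdeal x k) : a ∈ initialIdeal x k := by
  obtain ⟨G, hG, hGa⟩ := (mem_initialIdeal_iff x k).mp ha
  have hs : (Pi.single ∅ a : Finset (Fin n) → A) ∈ initialChains A n 0 k := fun S hS =>
    Pi.single_eq_of_ne (M := fun _ => A) (i := ∅) (i' := S) (by rintro rfl; simp at hS) a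
  have hDs : totalKoszulD x (koszulWedge k (Pi.single ∅ a) : Finset (Fin n) → A) =
      x k • (Pi.single ∅ a : Finset (Fin n) → A) := by
    rw [totalKoszulD_koszulWedge, totalKoszulD_eq_zero x hs, map_zero, sub_zero]
  have hDG : totalKoszulD x G = x k • (Pi.single ∅ a : Finset (Fin n) → A) :=
    initialChains_zero_ext (totalKoszulD_mem_initialChains x hG) (Submodule.smul_mem _ _ hs)
      (by rw [hGa]; simp)
  obtain ⟨g, hg, hgF⟩ := h (show koszulWedge k (Pi.single ∅ a) - G ∈ initialCycles x 1 (k.1 + 1)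
    from ⟨sub_mem (koszulWedge_mem_initialChains k (Nat.lt_succ_self _) (Nat.le_succ _) hs)
      (initialChains_mono (Nat.le_succ _) hG), by
      change totalKoszulD x _ = 0
      rw [map_sub, hDs, hDG, sub_self]⟩)
  rw [mem_initialIdeal_iff]
  refine ⟨-koszulContract k g, neg_mem (koszulContract_mem_initialChains k hg), ?_⟩
  rw [map_neg, totalKoszulD_koszulContract, neg_neg, hgF, map_sub, koszulContract_koszulWedge k hs,
    koszulContract_eq_zero k hG]
  simp

end TotalKoszul

/-! ## Comparison with the graded Koszul complex -/

section KoszulComparison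

variable {A : Type u} [CommRing A] {n : ℕ} (x : Fin n → A)

/-- The extension by zero of a chain of degree `i`. -/
def koszulExt (A : Type u) [CommRing A] (n i : ℕ) :
    KoszulChain n i A →ₗ[A] (Finset (Fin n) → A) :=
  LinearMap.pi fun S => if h : S.card = i then LinearMap.proj ⟨S, h⟩ else 0

theorem koszulExt_apply_of_card {i : ℕ} (f : KoszulChain n i A) {S : Finset (Fin n)}
    (h : S.card = i) : koszulExt A n i f S = f ⟨S, h⟩ := by
  simp [koszulExt, h]

theorem koszulExt_apply_of_card_ne {i : ℕ} (f : KoszulChain n i A) {S : Finset (Fin n)}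
    (h : S.card ≠ i) : koszulExt A n i f S = 0 := by
  simp [koszulExt, h]

theorem koszulExt_injective (i : ℕ) : Function.Injective (koszulExt A n i) := fun f g h =>
  funext fun S => by
    have := congrFun h S.1
    rwa [koszulExt_apply_of_card f S.2, koszulExt_apply_of_card g S.2] at this

theorem range_koszulExt (i : ℕ) :
    LinearMap.range (koszulExt A n i) = initialChains A n i n := by
  ext F
  constructor
  · rintro ⟨f, rfl⟩ S hS
    exact koszulExt_apply_of_card_ne f fun h => hS ⟨h, fun j _ => j.2⟩
  · intro hF
    refine ⟨fun S => F S.1, funext fun S => ?_⟩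
    by_cases h : S.card = i
    · rw [koszulExt_apply_of_card _ h]
    · rw [koszulExt_apply_of_card_ne _ h, hF S fun h' => h h'.1]

theorem totalKoszulD_koszulExt (i : ℕ) (f : KoszulChain n (i + 1) A) :
    totalKoszulD x (koszulExt A n (i + 1) f) = koszulExt A n i (koszulD x A i f) := by
  ext S
  by_cases h : S.card = i
  · rw [koszulExt_apply_of_card _ h, totalKoszulD_apply]
    simp only [koszulD, LinearMap.pi_apply, LinearMap.sum_apply, LinearMap.smul_apply,
      LinearMap.proj_apply, smul_eq_mul]
    rw [← Finset.sum_filter_add_sum_filter_not _ (fun s => s ∈ S),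
      Finset.sum_eq_zero (fun s hs => if_pos (Finset.mem_filter.mp hs).2), zero_add,
      Finset.sum_subtype (p := fun s => s ∉ S) _ (by simp)]
    refine Finset.sum_congr rfl fun s _ => ?_
    rw [if_neg s.2, koszulExt_apply_of_card]
  · rw [koszulExt_apply_of_card_ne _ h]
    have := totalKoszulD_mem_initialChains x (k := n) (F := koszulExt A n (i + 1) f)
      (by rw [← range_koszulExt]; exact ⟨f, rfl⟩)
    exact this S fun h' => h h'.1

theorem koszulExt_mem_initialCycles {i : ℕ} (f : KoszulChain n (i + 1) A) :
    koszulExt A n (i + 1) f ∈ initialCycles x (i + 1) n ↔ f ∈ koszulCycles x A (i + 1) := by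
  rw [initialCycles, ← range_koszulExt, Submodule.mem_inf, LinearMap.mem_ker,
    totalKoszulD_koszulExt, map_eq_zero_iff _ (koszulExt_injective i)]
  exact ⟨fun h => h.2, fun h => ⟨⟨f, rfl⟩, h⟩⟩

theorem koszulExt_mem_initialBoundaries {i : ℕ} (f : KoszulChain n i A) :
    koszulExt A n i f ∈ initialBoundaries x i n ↔ f ∈ LinearMap.range (koszulD x A i) := by
  rw [initialBoundaries, ← range_koszulExt]
  constructor
  · rintro ⟨_, ⟨g, rfl⟩, h⟩
    rw [totalKoszulD_koszulExt] at h
    exact ⟨g, koszulExt_injective i h⟩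
  · rintro ⟨g, rfl⟩
    exact ⟨_, ⟨g, rfl⟩, totalKoszulD_koszulExt x i g⟩

theorem koszulExt_mem_almostClosure {v : ValueMap A} (hv : v 1 = 0) {i : ℕ}
    (f : KoszulChain n i A) :
    koszulExt A n i f ∈ almostClosure hv (initialBoundaries x i n) ↔
      f ∈ almostClosure hv (LinearMap.range (koszulD x A i)) := by
  simp only [mem_almostClosure, ← map_smul, koszulExt_mem_initialBoundaries]

theorem koszulCycles_le_almostClosure_iff {v : ValueMap A} (hv : v 1 = 0) (i : ℕ) :
    koszulCycles x A (i + 1) ≤ almostClosure hv (LinearMap.range (koszulD x A (i + 1))) ↔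
      initialCycles x (i + 1) n ≤ almostClosure hv (initialBoundaries x (i + 1) n) := by
  constructor
  · intro h F hF
    obtain ⟨f, rfl⟩ : F ∈ LinearMap.range (koszulExt A n (i + 1)) := by
      rw [range_koszulExt]; exact hF.1
    exact (koszulExt_mem_almostClosure x hv f).mpr (h ((koszulExt_mem_initialCycles x f).mp hF))
  · intro h f hf
    exact (koszulExt_mem_almostClosure x hv f).mp (h ((koszulExt_mem_initialCycles x f).mpr hf))

/-- The elements of the sequence annihilate Koszul homology. -/
theorem smul_mem_range_koszulD {i : ℕ} {f : KoszulChain n (i + 1) A}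
    (hf : f ∈ koszulCycles x A (i + 1)) (s : Fin n) :
    x s • f ∈ LinearMap.range (koszulD x A (i + 1)) := by
  rw [← koszulExt_mem_initialBoundaries]
  have h := (koszulExt_mem_initialCycles x f).mpr hf
  refine ⟨_, koszulWedge_mem_initialChains s s.2 le_rfl h.1, ?_⟩
  rw [totalKoszulD_koszulWedge, LinearMap.mem_ker.mp h.2, map_zero, sub_zero, map_smul]

end KoszulComparison

/-! ## Koszul homology and Čech cohomology -/

section ExactSequences

variable {A : Type u} [CommRing A] {M N : Type w} [AddCommGroup M] [Module A M] [AddCommGroup N]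
  [Module A N]

theorem exact_inclusion_mkQ_submoduleOf {L K : Submodule A M} (h : L ≤ K) :
    Function.Exact (Submodule.inclusion h) (L.submoduleOf K).mkQ := by
  intro m
  rw [Submodule.mkQ_apply, Submodule.Quotient.mk_eq_zero]
  exact ⟨fun hm => ⟨⟨m, hm⟩, rfl⟩, fun ⟨l, hl⟩ => hl ▸ l.2⟩

theorem exact_subtype_ker_rangeRestrict (f : M →ₗ[A] N) :
    Function.Exact (LinearMap.ker f).subtype f.rangeRestrict := by
  intro m
  rw [← LinearMap.mem_ker, LinearMap.ker_rangeRestrict]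
  exact ⟨fun hm => ⟨⟨m, hm⟩, rfl⟩, fun ⟨l, hl⟩ => hl ▸ l.2⟩

end ExactSequences

/-! ### Koszul boundaries, cycles and homology as coefficients of Čech cohomology. -/

section KoszulCech

theorem koszulChain_subsingleton {m i : ℕ} (h : m < i) (A : Type u) :
    Subsingleton (KoszulChain m i A) := by
  have : IsEmpty {S : Finset (Fin m) // S.card = i} :=
    ⟨fun S => by have := Finset.card_le_univ S.1; rw [S.2, Fintype.card_fin] at this; omega⟩
  infer_instance

variable {A : Type u} [CommRing A] {v : ValueMap A} (hv : v 1 = 0) {n m : ℕ}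
  (y : Fin n → A) (x : Fin m → A)

theorem range_koszulD_le_koszulCycles (i : ℕ) :
    LinearMap.range (koszulD x A i) ≤ koszulCycles x A i := by
  cases i with
  | zero => exact le_top
  | succ i =>
    rintro _ ⟨f, rfl⟩
    exact koszulD_koszulD x A i f

theorem exact_subtype_koszulCycles (i : ℕ) :
    Function.Exact (koszulCycles x A (i + 1)).subtype (koszulD x A i).rangeRestrict :=
  exact_subtype_ker_rangeRestrict _

theorem mem_almostClosure_bot_of_subsingleton {M : Type w} [AddCommGroup M] [Module A M]
    [Subsingleton M] (a : M) : a ∈ almostClosure hv (⊥ : Submodule A M) := by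
  rw [Subsingleton.elim a 0]; exact zero_mem _

/-- A module whose elements are killed by powers of the `y s` and whose zeroth Čech cohomology is
almost zero is almost zero. -/
theorem mem_almostClosure_bot_of_torsion {M : Type w} [AddCommGroup M] [Module A M]
    (h : CechAlmostZero hv y M 0) (htors : ∀ (a : M) (s : Fin n), ∃ N : ℕ, y s ^ N • a = 0) (a : M) :
    a ∈ almostClosure hv (⊥ : Submodule A M) := by
  -- The degree zero cochains are `M` localized at the empty product `1`, that is, `M` itself.
  -- Torsion elements die in every `M_{y_t}`, so they are cocycles.
  let z : CechCochain y M 0 := fun S => LocalizedModule.mkLinearMap _ M a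
  have hz : z ∈ LinearMap.ker (cechD y M 0) := by
    rw [LinearMap.mem_ker]
    ext1 S
    obtain ⟨s, hs⟩ := Finset.card_eq_one.mp S.2
    rw [cechD_apply]
    refine Finset.sum_eq_zero fun t ht => ?_
    have hc : (S.1.erase t).card = 0 := by rw [Finset.card_erase_of_mem ht, S.2]
    rw [cechExt, dif_pos hc, cechRes, awayMap_mkLinearMap]
    obtain ⟨N, hN⟩ := htors a t
    rw [LocalizedModule.mkLinearMap_apply, (LocalizedModule.mk_eq_zero _ _).mpr, smul_zero]
    obtain ⟨c, hc⟩ := Finset.dvd_prod_of_mem y ht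
    refine ⟨⟨(∏ s ∈ S.1, y s) ^ N, N, rfl⟩, ?_⟩
    change (∏ s ∈ S.1, y s) ^ N • a = 0
    rw [hc, mul_pow, mul_comm, mul_smul, hN, smul_zero]
  intro ε hε
  obtain ⟨b, hb, hbz⟩ := h hz ε hε
  refine ⟨b, hb, ?_⟩
  have h1 : (b • z) ⟨∅, rfl⟩ = 0 := congrFun ((Submodule.mem_bot A).mp hbz) _
  rw [Pi.smul_apply, ← map_smul, LocalizedModule.mkLinearMap_apply,
    LocalizedModule.mk_eq_zero] at h1
  obtain ⟨⟨_, k, rfl⟩, hk⟩ := h1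
  have hk : (∏ s ∈ (∅ : Finset (Fin n)), y s) ^ k • b • a = 0 := hk
  simpa using hk

theorem forall_koszulHomology_iff (i : ℕ) :
    (∀ a : KoszulHomology x A i, a ∈ almostClosure hv (⊥ : Submodule A (KoszulHomology x A i))) ↔
      koszulCycles x A i ≤ almostClosure hv (LinearMap.range (koszulD x A i)) := by
  rw [← isAlmostZero_iff hv, isAlmostZero_quotient_iff hv]

/-- The Koszul homology in a positive degree is almost zero if the Čech cohomology of the boundaries
in that degree is almost zero in degree one. -/
theorem koszulHomology_almostZero_of_range (hyx : ∀ s, y s ∈ (Ideal.span (Set.range x)).radical)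
    {i : ℕ} (hA : CechAlmostZero hv y A 0)
    (hB : CechAlmostZero hv y (LinearMap.range (koszulD x A (i + 1))) 1) :
    ∀ a : KoszulHomology x A (i + 1),
      a ∈ almostClosure hv (⊥ : Submodule A (KoszulHomology x A (i + 1))) := by
  have hK : CechAlmostZero hv y (KoszulChain m (i + 1) A) 0 := CechAlmostZero.pi hv y hA
  have hZ : CechAlmostZero hv y (koszulCycles x A (i + 1)) 0 :=
    CechAlmostZero.left_zero hv y (f := (koszulCycles x A (i + 1)).subtype)
      Subtype.val_injective hK
  have hle := range_koszulD_le_koszulCycles x (i + 1)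
  have hH : CechAlmostZero hv y (KoszulHomology x A (i + 1)) 0 :=
    CechAlmostZero.right hv y (Submodule.inclusion_injective hle) (Submodule.mkQ_surjective _)
      (exact_inclusion_mkQ_submoduleOf hle) hZ hB
  refine mem_almostClosure_bot_of_torsion hv y hH fun a s => ?_
  obtain ⟨N, hN⟩ := hyx s
  refine ⟨N, ?_⟩
  have hann : Ideal.span (Set.range x) ≤ Ideal.comap (algebraMap A A)
      (LinearMap.ker (LinearMap.toSpanSingleton A (KoszulHomology x A (i + 1)) a)) := by
    rw [Ideal.span_le]
    rintro _ ⟨j, rfl⟩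
    obtain ⟨f, rfl⟩ := Submodule.Quotient.mk_surjective _ a
    change x j • (Submodule.Quotient.mk f : KoszulHomology x A (i + 1)) = 0
    rw [← Submodule.Quotient.mk_smul, Submodule.Quotient.mk_eq_zero]
    exact smul_mem_range_koszulD x f.2 j
  exact hann hN

/-- If the Čech cohomology of `A` is almost zero in degrees below `m`, then the Koszul homology of
`m` elements generating the same ideal up to radical is almost zero in positive degrees. -/
theorem koszulHomology_almostZero_of_cech
    (hyx : ∀ s, y s ∈ (Ideal.span (Set.range x)).radical)
    (hA : ∀ q < m, CechAlmostZero hv y A q) (i : ℕ) :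
    ∀ a : KoszulHomology x A (i + 1),
      a ∈ almostClosure hv (⊥ : Submodule A (KoszulHomology x A (i + 1))) := by
  have htriv : ∀ i, m ≤ i → ∀ q, CechAlmostZero hv y (LinearMap.range (koszulD x A i)) q := by
    intro i hi q
    have := koszulChain_subsingleton (Nat.lt_succ_of_le hi) A
    have : Subsingleton (LinearMap.range (koszulD x A i)) :=
      (LinearMap.surjective_rangeRestrict (koszulD x A i)).subsingleton
    exact CechAlmostZero.of_forall hv y (mem_almostClosure_bot_of_subsingleton hv) q
  -- Descending induction from `B_m = 0`. Vanishing of `H^1(B_{i+1})` makes the torsion module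
  -- `H_{i+1}` almost zero; hence `H^{q+1}(Z_{i+1})` is almost zero, and the sequence with quotient
  -- `B_i` lowers the degree by one.
  have key : ∀ i, i ≤ m → ∀ q ≤ i, CechAlmostZero hv y (LinearMap.range (koszulD x A i)) q := by
    intro i hi
    induction hi using Nat.decreasingInduction with
    | self => exact fun q _ => htriv m le_rfl q
    | of_succ i hi ih =>
      intro q hq
      have hH := koszulHomology_almostZero_of_range hv y x hyx
        (hA 0 (Nat.zero_lt_of_lt hi)) (ih 1 (by omega))
      have hle := range_koszulD_le_koszulCycles x (i + 1)
      have hZ : CechAlmostZero hv y (koszulCycles x A (i + 1)) (q + 1) :=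
        CechAlmostZero.middle hv y (Submodule.inclusion_injective hle)
          (Submodule.mkQ_surjective _) (exact_inclusion_mkQ_submoduleOf hle)
          (ih (q + 1) (by omega)) (CechAlmostZero.of_forall hv y hH _)
      exact CechAlmostZero.right hv y (f := (koszulCycles x A (i + 1)).subtype)
        (g := (koszulD x A i).rangeRestrict) Subtype.val_injective
        (LinearMap.surjective_rangeRestrict _) (exact_subtype_koszulCycles x i)
        (CechAlmostZero.pi hv y (hA q (by omega))) hZ
  rcases Nat.lt_or_ge i m with hi | hi
  · exact koszulHomology_almostZero_of_range hv y x hyx (hA 0 (Nat.zero_lt_of_lt hi))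
      (key (i + 1) hi 1 (by omega))
  · have := koszulChain_subsingleton (Nat.lt_succ_of_le hi) A
    have : Subsingleton (KoszulHomology x A (i + 1)) :=
      (Submodule.mkQ_surjective _).subsingleton
    exact mem_almostClosure_bot_of_subsingleton hv

/-- Ascending induction on `q`. In degree zero `B_i` inherits vanishing from `K_i`. Then `H^q(B_i)`
controls `H^{q+1}(Z_{i+1})`, and almost vanishing of `H_{i+1}` carries this over to `B_{i+1}`. -/
theorem cechAlmostZero_range_koszulD
    (hH : ∀ i, ∀ a : KoszulHomology x A (i + 1),
      a ∈ almostClosure hv (⊥ : Submodule A (KoszulHomology x A (i + 1))))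
    {r : ℕ} (hA : ∀ q < r, CechAlmostZero hv y A q) (q : ℕ) (hq : q < r) (i : ℕ) (hi : q ≤ i) :
    CechAlmostZero hv y (LinearMap.range (koszulD x A i)) q := by
  induction q generalizing i with
  | zero =>
    exact CechAlmostZero.left_zero hv y (f := (LinearMap.range (koszulD x A i)).subtype)
      Subtype.val_injective (CechAlmostZero.pi hv y (hA 0 hq))
  | succ q ih =>
    obtain ⟨i, rfl⟩ : ∃ j, i = j + 1 := ⟨i - 1, by omega⟩
    have hZ : CechAlmostZero hv y (koszulCycles x A (i + 1)) (q + 1) :=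
      CechAlmostZero.left_succ hv y (f := (koszulCycles x A (i + 1)).subtype)
        (g := (koszulD x A i).rangeRestrict) Subtype.val_injective
        (LinearMap.surjective_rangeRestrict _) (exact_subtype_koszulCycles x i)
        (ih (by omega) i (by omega)) (CechAlmostZero.pi hv y (hA (q + 1) hq))
    have hle := range_koszulD_le_koszulCycles x (i + 1)
    exact CechAlmostZero.left_succ hv y (Submodule.inclusion_injective hle)
      (Submodule.mkQ_surjective _) (exact_inclusion_mkQ_submoduleOf hle)
      (CechAlmostZero.of_forall hv y (hH i) q) hZ

/-- If the Koszul homology of `x₁, …, x_m` is almost zero in positive degrees, then the classes in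
the first Čech cohomology module that is not almost zero and has degree below `m` are almost zero
as soon as they are killed by `x₁, …, x_m`. -/
theorem mem_almostClosure_of_koszulHomology
    (hH : ∀ i, ∀ a : KoszulHomology x A (i + 1),
      a ∈ almostClosure hv (⊥ : Submodule A (KoszulHomology x A (i + 1))))
    {r : ℕ} (hr : r < m) (hA : ∀ q < r, CechAlmostZero hv y A q) {z : CechCochain y A r}
    (hz : z ∈ LinearMap.ker (cechD y A r)) (hxz : ∀ s, x s • z ∈ cechCoboundaries y A r) :
    z ∈ almostClosure hv (cechCoboundaries y A r) := by
  obtain ⟨d, rfl⟩ : ∃ d, m = d + 1 := ⟨m - 1, by omega⟩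
  -- The top chain module has the single index set `Finset.univ`, so `e` identifies it with `A`.
  let e : A →ₗ[A] KoszulChain (d + 1) (d + 1) A := LinearMap.pi fun _ => LinearMap.id
  let p : KoszulChain (d + 1) (d + 1) A →ₗ[A] A :=
    LinearMap.proj ⟨Finset.univ, by rw [Finset.card_univ, Fintype.card_fin]⟩
  have hpe : p ∘ₗ e = LinearMap.id := rfl
  suffices hez : cechMap y e r z ∈ almostClosure hv (cechCoboundaries y _ r) by
    have := map_mem_almostClosure hv (cechMap y p r) (cechMap_mem_cechCoboundaries y p r) hez
    rwa [← cechMap_comp, hpe, cechMap_id] at this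
  have hezk := cechMap_mem_ker y e hz
  let D := koszulD x A d
  -- The kernel of the top differential is the top Koszul homology, because there are no chains
  -- above it.
  have hker : CechAlmostZero hv y (LinearMap.ker D) r := by
    refine CechAlmostZero.of_forall hv y (fun a ε hε => ?_) r
    obtain ⟨b, hb, hba⟩ := (forall_koszulHomology_iff hv x (d + 1)).mp (hH d) a.2 ε hε
    refine ⟨b, hb, Subtype.ext ?_⟩
    obtain ⟨f, hf⟩ := hba
    have := koszulChain_subsingleton (Nat.lt_succ_self (d + 1)) A
    rw [Subsingleton.elim f 0, map_zero] at hf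
    exact hf.symm
  refine mem_almostClosure_of_cechMap_right hv y (f := (LinearMap.ker D).subtype)
    (g := D.rangeRestrict) Subtype.val_injective (LinearMap.surjective_rangeRestrict _)
    (exact_subtype_ker_rangeRestrict _) hker hezk ?_
  have himage : cechMap y D r (cechMap y e r z) ∈ almostClosure hv (cechCoboundaries y _ r) := by
    refine mem_almostClosure_cechCoboundaries_pi hv y _ fun S => le_almostClosure hv _ ?_
    have hcomp : (LinearMap.proj S ∘ₗ D) ∘ₗ e = ∑ s : {s // s ∉ S.1},
        (alternatingSign A S.1 s * x s) • (LinearMap.id : A →ₗ[A] A) := by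
      ext
      simp [D, e, koszulD]
    rw [← cechMap_comp, ← cechMap_comp, hcomp, cechMap_sum]
    refine sum_mem fun s _ => ?_
    rw [cechMap_smul, cechMap_id, mul_smul]
    exact Submodule.smul_mem _ _ (hxz s)
  -- It remains to descend from `K_d` to `range D`. In degree zero cohomology is left exact. In
  -- higher degree the obstructions are `H^{r-1}(B_{d-1})` for `Z_d ⊆ K_d` and `H^{r-1}(H_d)` for
  -- `range D ⊆ Z_d`, both almost zero.
  cases r with
  | zero =>
    refine mem_almostClosure_of_cechMap_zero hv y (f := (LinearMap.range D).subtype)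
      Subtype.val_injective ?_
    rw [← cechMap_comp]
    exact himage
  | succ q =>
    obtain ⟨i, rfl⟩ : ∃ j, d = j + 1 := ⟨d - 1, by omega⟩
    have hle := range_koszulD_le_koszulCycles x (i + 1)
    refine mem_almostClosure_of_cechMap_succ hv y (Submodule.inclusion_injective hle)
      (Submodule.mkQ_surjective _) (exact_inclusion_mkQ_submoduleOf hle)
      (CechAlmostZero.of_forall hv y (hH i) q) ?_
    refine mem_almostClosure_of_cechMap_succ hv y (f := (koszulCycles x A (i + 1)).subtype)
      (g := (koszulD x A i).rangeRestrict) Subtype.val_injective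
      (LinearMap.surjective_rangeRestrict _) (exact_subtype_koszulCycles x i)
      (cechAlmostZero_range_koszulD hv y x hH hA q (by omega) i (by omega)) ?_
    rw [← cechMap_comp, ← cechMap_comp, ← cechMap_comp]
    rw [← cechMap_comp] at himage
    exact himage

end KoszulCech

/-! ## Systems of parameters -/

section SystemsOfParameters

variable {R : Type u} [CommRing R] [IsLocalRing R]

/-- By the converse of Krull's height theorem the maximal ideal is minimal over an ideal with
`height = d` generators; any prime over that ideal is then maximal. -/
theorem exists_isSystemOfParameters [IsNoetherianRing R] {d : ℕ} (hd : ringKrullDim R = d) :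
    ∃ x : Fin d → R, IsSystemOfParameters x := by
  obtain ⟨s, hs, hcard⟩ :=
    (IsLocalRing.maximalIdeal R).exists_finset_card_eq_height_of_isNoetherianRing
  have hsd : s.card = d := by
    have h := IsLocalRing.maximalIdeal_height_eq_ringKrullDim (R := R)
    rw [hd, ← hcard] at h
    exact_mod_cast h
  let e := s.equivFinOfCardEq hsd
  refine ⟨fun i => (e.symm i).1, hd, ?_⟩
  have hr : Set.range (fun i => (e.symm i).1) = (s : Set R) := by
    ext a
    constructor
    · rintro ⟨i, rfl⟩
      exact (e.symm i).2
    · intro ha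
      exact ⟨e ⟨a, ha⟩, by simp⟩
  rw [hr]
  refine le_antisymm ((IsLocalRing.maximalIdeal.isMaximal R).isPrime.radical_le_iff.mpr hs.1.2) ?_
  rw [Ideal.radical_eq_sInf]
  refine le_sInf fun p ⟨hp, hp'⟩ => hs.2 ⟨hp', hp⟩ (IsLocalRing.le_maximalIdeal hp'.ne_top)

theorem IsSystemOfParameters.pow {d : ℕ} {x : Fin d → R} (hx : IsSystemOfParameters x) (t : ℕ)
    (ht : t ≠ 0) : IsSystemOfParameters (fun i => x i ^ t) := by
  refine ⟨hx.1, le_antisymm ?_ ?_⟩ <;> rw [← hx.2]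
  · refine Ideal.radical_mono (Ideal.span_le.mpr ?_)
    rintro _ ⟨i, rfl⟩
    have h : x i ∈ Ideal.span (Set.range x) := Ideal.subset_span ⟨i, rfl⟩
    exact Ideal.pow_mem_of_mem _ h t (Nat.pos_of_ne_zero ht)
  · refine Ideal.radical_le_radical_iff.mpr (Ideal.span_le.mpr ?_)
    rintro _ ⟨i, rfl⟩
    exact ⟨t, Ideal.subset_span ⟨i, rfl⟩⟩

theorem IsSystemOfParameters.mem_maximalIdeal {d : ℕ} {x : Fin d → R}
    (hx : IsSystemOfParameters x) (i : Fin d) : x i ∈ IsLocalRing.maximalIdeal R := by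
  rw [← hx.2]
  exact Ideal.le_radical (Ideal.subset_span ⟨i, rfl⟩)

end SystemsOfParameters

/-! ## Regular sequences and colon ideals -/

section Regular

theorem setOf_mem_take_ofFn {A : Type*} {d : ℕ} (x : Fin d → A) (i : Fin d) :
    {r | r ∈ (List.ofFn x).take i} = x '' {j | j < i} := by
  ext r
  rw [Set.mem_ofPred_eq, List.mem_take_iff_getElem]
  constructor
  · rintro ⟨j, hj, rfl⟩
    have hj' : j < i.1 ∧ j < d := by
      have h := hj
      rw [List.length_ofFn, lt_min_iff] at h
      exact h
    exact ⟨⟨j, hj'.2⟩, hj'.1, by simp⟩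
  · rintro ⟨j, hj, rfl⟩
    exact ⟨j, by simpa using hj, by simp⟩

theorem isWeaklyRegular_ofFn {A : Type*} [CommRing A] {d : ℕ} (x : Fin d → A)
    (h : ∀ (k : Fin d) (a : A), x k * a ∈ initialIdeal x k → a ∈ initialIdeal x k) :
    RingTheory.Sequence.IsWeaklyRegular A (List.ofFn x) := by
  refine ⟨fun i hi => ?_⟩
  have hi' : i < d := by simpa using hi
  have e : (Ideal.ofList ((List.ofFn x).take i) • ⊤ : Submodule A A) =
      initialIdeal x ⟨i, hi'⟩ := by
    rw [smul_eq_mul, Ideal.mul_top, Ideal.ofList, initialIdeal]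
    exact congrArg Ideal.span (setOf_mem_take_ofFn x ⟨i, hi'⟩)
  rw [e, isSMulRegular_quotient_iff_mem_of_smul_mem]
  intro a ha
  refine h ⟨i, hi'⟩ a ?_
  simpa using ha

end Regular

/-! ### The three implications for an algebra over a local ring. -/

section Main

variable {R : Type u} [CommRing R] {B : Type w} [CommRing B] [Algebra R B]
  {v : ValueMap B}

theorem isAlmostZero_koszulHomology_of_colonQuotient (hv : v 1 = 0) {d : ℕ} (x : Fin d → B)
    (h : ∀ i, IsAlmostZero v (ColonQuotient x i)) {i : ℕ} (hi : 0 < i) :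
    IsAlmostZero v (KoszulHomology x B i) := by
  obtain ⟨i, rfl⟩ : ∃ j, i = j + 1 := ⟨i - 1, by omega⟩
  rw [isAlmostZero_quotient_iff hv, koszulCycles_le_almostClosure_iff x hv]
  refine initialCycles_le_almostClosure x hv (fun k a ha => ?_) d le_rfl i
  refine (isAlmostZero_quotient_iff hv _ _).mp (h k) ?_
  rw [Submodule.mem_colon_singleton, smul_eq_mul, mul_comm]
  exact ha

/-- Every Čech cohomology class is killed by powers of the elements of the ideal generated by the
`y s`. -/
theorem exists_pow_smul_mem_cechCoboundaries_of_mem_span {n : ℕ} (y : Fin n → R) {q : ℕ}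
    {z : CechCochain (fun j => algebraMap R B (y j)) B q}
    (hz : z ∈ LinearMap.ker (cechD (fun j => algebraMap R B (y j)) B q)) {r : R}
    (hr : r ∈ Ideal.span (Set.range y)) :
    ∃ N : ℕ, algebraMap R B r ^ N • z ∈ cechCoboundaries (fun j => algebraMap R B (y j)) B q := by
  let I : Ideal R := Ideal.comap (algebraMap R B) (Submodule.comap
    (LinearMap.toSpanSingleton B _ z) (cechCoboundaries (fun j => algebraMap R B (y j)) B q))
  have hI : Ideal.span (Set.range y) ≤ I.radical := by
    rw [Ideal.span_le]
    rintro _ ⟨s, rfl⟩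
    obtain ⟨N, hN⟩ := exists_pow_smul_mem_cechCoboundaries _ hz s
    refine ⟨N, ?_⟩
    change algebraMap R B (y s ^ N) • z ∈ cechCoboundaries (fun j => algebraMap R B (y j)) B q
    rwa [map_pow]
  obtain ⟨N, hN⟩ := hI hr
  refine ⟨N, ?_⟩
  rw [← map_pow]
  exact hN

variable [IsLocalRing R]

theorem cechAlmostZero_of_koszulHomology (hv : v 1 = 0) [IsNoetherianRing R] {d : ℕ} (hd : ringKrullDim R = d)
    {n : ℕ} (y : Fin n → R) (hy : Ideal.span (Set.range y) = IsLocalRing.maximalIdeal R)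
    (h : ∀ x : Fin d → R, IsSystemOfParameters x →
      ∀ i : ℕ, 0 < i → IsAlmostZero v (KoszulHomology (fun j => algebraMap R B (x j)) B i))
    (q : ℕ) (hq : q < d) : CechAlmostZero hv (fun j => algebraMap R B (y j)) B q := by
  induction q using Nat.strong_induction_on with
  | _ q ih =>
    intro z hz
    obtain ⟨x, hx⟩ := exists_isSystemOfParameters hd
    have hN : ∀ i, ∃ N : ℕ, algebraMap R B (x i) ^ N • z ∈ cechCoboundaries _ B q := fun i =>
      exists_pow_smul_mem_cechCoboundaries_of_mem_span y hz (hy ▸ hx.mem_maximalIdeal i)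
    choose N hN using hN
    -- The `+ 1` keeps the exponent positive, so that the powers still form a system of parameters.
    let t := Finset.univ.sup N + 1
    refine mem_almostClosure_of_koszulHomology hv _ (fun i => algebraMap R B (x i ^ t))
      (fun i => ?_) hq (fun r hr => ih r hr (hr.trans hq)) hz (fun s => ?_)
    · rw [← isAlmostZero_iff hv]
      exact h _ (hx.pow t (Nat.succ_ne_zero _)) (i + 1) (Nat.succ_pos i)
    · obtain ⟨k, hk⟩ := Nat.exists_eq_add_of_le
        ((Finset.le_sup (f := N) (Finset.mem_univ s)).trans (Nat.le_succ _))
      have : t = k + N s := by rw [add_comm]; exact hk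
      rw [this, map_pow, pow_add, mul_smul]
      exact Submodule.smul_mem _ _ (hN s)

theorem IsStrict.map_ne_top (hB : IsStrict R B) :
    (IsLocalRing.maximalIdeal R).map (algebraMap R B) ≠ ⊤ := by
  intro h
  refine hB ?_
  rw [Ideal.smul_top_eq_map, h]
  rfl

theorem isBalancedBigCohenMacaulay_of_cechAlmostZero (hv : v 1 = 0) (hB : IsStrict R B) {d : ℕ}
    (hd : ringKrullDim R = d) {n : ℕ} (y : Fin n → R)
    (hy : Ideal.span (Set.range y) = IsLocalRing.maximalIdeal R) (hn : v.IsNormalized)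
    (hloc : IsLocalRing B) (hcoh : IsCoherentRing B)
    (h : ∀ q < d, CechAlmostZero hv (fun j => algebraMap R B (y j)) B q) :
    IsBalancedBigCohenMacaulay R B := by
  refine ⟨hB, fun d' x hx => ?_⟩
  obtain rfl : d' = d := by
    have := hx.1.symm.trans hd
    exact_mod_cast this
  let x' : Fin d' → B := fun j => algebraMap R B (x j)
  have hmap : (Ideal.span (Set.range x)).map (algebraMap R B) = Ideal.span (Set.range x') := by
    rw [Ideal.map_span, ← Set.range_comp]; rfl
  have hyx : ∀ s, algebraMap R B (y s) ∈ (Ideal.span (Set.range x')).radical := fun s => by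
    have : y s ∈ (Ideal.span (Set.range x)).radical := by
      rw [hx.2, ← hy]; exact Ideal.subset_span ⟨s, rfl⟩
    obtain ⟨N, hN⟩ := this
    exact ⟨N, by rw [← map_pow, ← hmap]; exact Ideal.mem_map_of_mem _ hN⟩
  -- Strictness makes the extension of the maximal ideal of `R` proper, hence contained in the
  -- maximal ideal of `B`.
  have hjac : ∀ j, x' j ∈ Ideal.jacobson (⊥ : Ideal B) := fun j => by
    rw [IsLocalRing.jacobson_eq_maximalIdeal ⊥ bot_ne_top]
    exact IsLocalRing.le_maximalIdeal hB.map_ne_top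
      (Ideal.mem_map_of_mem _ (hx.mem_maximalIdeal j))
  have hH := koszulHomology_almostZero_of_cech hv _ x' hyx h 0
  rw [forall_koszulHomology_iff, koszulCycles_le_almostClosure_iff] at hH
  have hH1 : initialCycles x' 1 d' ≤ initialBoundaries x' 1 d' :=
    hH.trans (hcoh.almostClosure_le hv hn _ ((initialChains_fg 2 d').map _))
  have hfg : ∀ k, (initialCycles x' 1 k).FG := fun k => hcoh.fg_inf_ker _ (initialChains_fg 1 k) _
  have hreg : RingTheory.Sequence.IsWeaklyRegular B (List.ofFn x') :=
    isWeaklyRegular_ofFn x' fun k a ha =>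
      mem_initialIdeal_of_mul_mem x' k (initialCycles_one_le_of_le x' hfg hjac hH1 k.2) ha
  refine ⟨?_, fun htop => hB ?_⟩
  · rw [← RingTheory.Sequence.isWeaklyRegular_map_algebraMap_iff B, List.map_ofFn]
    exact hreg
  · refine top_le_iff.mp (htop.le.trans (Submodule.smul_mono_left (Ideal.span_le.mpr ?_)))
    intro r hr
    obtain ⟨i, rfl⟩ := (List.mem_ofFn' _ _).mp hr
    exact hx.mem_maximalIdeal i

end Main

theorem proposition5p5
    {R : Type u} [CommRing R] [IsNoetherianRing R] [IsLocalRing R]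
    {B : Type w} [CommRing B] [Algebra R B] (hB : IsStrict R B)
    (d : ℕ) (hd : ringKrullDim R = d)
    (v : ValueMap B) (hv : ∃ b : B, v b ≠ ⊤)
    -- local cohomology at the maximal ideal is computed by the Čech complex
    -- on any finite sequence `y` of generators of the maximal ideal
    {n : ℕ} (y : Fin n → R) (hy : Ideal.span (Set.range y) = IsLocalRing.maximalIdeal R) :
    -- (a) implies (b)
    ((∀ x : Fin d → R, IsSystemOfParameters x →
        ∀ i : Fin d, IsAlmostZero v (ColonQuotient (fun j => algebraMap R B (x j)) i)) →
      ∀ x : Fin d → R, IsSystemOfParameters x →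
        ∀ i : ℕ, 0 < i → IsAlmostZero v (KoszulHomology (fun j => algebraMap R B (x j)) B i)) ∧
    -- (b) implies (c)
    ((∀ x : Fin d → R, IsSystemOfParameters x →
        ∀ i : ℕ, 0 < i → IsAlmostZero v (KoszulHomology (fun j => algebraMap R B (x j)) B i)) →
      ∀ i : ℕ, i < d → IsAlmostZero v (CechCohomology (fun j => algebraMap R B (y j)) B i)) ∧
    -- (c) implies balanced big Cohen-Macaulay, under the additional hypotheses
    (v.IsNormalized → IsLocalRing B → IsCoherentRing B →
      (∀ i : ℕ, i < d → IsAlmostZero v (CechCohomology (fun j => algebraMap R B (y j)) B i)) →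
      IsBalancedBigCohenMacaulay R B) := by
  have hv1 := ValueMap.map_one_of_ne_top hv
  refine ⟨fun h x hx i hi => isAlmostZero_koszulHomology_of_colonQuotient hv1 _ (h x hx) hi,
    fun h i hi => ?_, fun hn hloc hcoh h => ?_⟩
  · rw [isAlmostZero_cechCohomology_iff hv1]
    exact cechAlmostZero_of_koszulHomology hv1 hd y hy h i hi
  · exact isBalancedBigCohenMacaulay_of_cechAlmostZero hv1 hB hd y hy hn hloc hcoh fun q hq =>
      (isAlmostZero_cechCohomology_iff hv1 _ q).mp (h q hq)
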